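/- Let $Q$ be a quiver whose arrow set is partitioned into $n+1$ parts ($n\ge 0$), called arrow types; let $T$ be the set of types. For a path $\gamma$ let $t_\gamma(a)$ be the number of arrows of type $a$ in $\gamma$. Call $\gamma$ *admissible* if $t_\gamma(a)=0$ for some $a\in T$, *simple* if $t_\gamma\le 1$, and a *minimal circuit* if it is simple and not admissible. Assume that $Q$ is a *$\mathbb Z^n$-quiver*: exactly one arrow of each type leaves each vertex; each vertex is connected to each other by an admissible path; two paths $\gamma_1,\gamma_2$ leaving the same vertex end at the same vertex if and only if $t_{\gamma_1}-t_{\gamma_2}$ is constant. Two distinct vertices are *neighbors* if a simple path connects them. Let $\Bbbk$ be a field, and let $\mathfrak V$ be a representation of $Q$ by $\Bbbk$-vector spaces $V_v$, all of dimension $r+1$, where $r\ge 0$ is an integer (in particular $\mathfrak V$ is nontrivial); write $\varphi_\gamma$ for the composition of its maps along a path $\gamma$. For $m\in\mathbb N\cup\{\infty\}$, $\mathfrak V$ is *$m$-generated* by a set $S$ of vertices if for each vertex $v$ there are finitely many (at most $m$) paths $\gamma_i$ from vertices $w_i\in S$ to $v$ such that $\bigoplus_i V_{w_i}\to V_v$,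 $(s_i)_i\mapsto\sum_i\varphi_{\gamma_i}(s_i)$, is surjective. Assume that: * $\mathfrak V$ is a *linked net*: (1) if $\gamma_1,\gamma_2$ connect the same two vertices and $\gamma_2$ is admissible, then $\varphi_{\gamma_1}$ is a scalar multiple of $\varphi_{\gamma_2}$; (2) $\varphi_\gamma=0$ for each minimal circuit $\gamma$; (3) if $\gamma_1,\gamma_2$ are admissible paths leaving the same vertex with no arrow type in common, then $\ker\varphi_{\gamma_1}\cap\ker\varphi_{\gamma_2}=0$; * $\mathfrak V$ is *exact*: $\operatorname{im}\varphi_\gamma=\ker\varphi_\delta$ for all neighbors $u_1,u_2$ and all admissible paths $\gamma$ from $u_1$ to $u_2$ and $\delta$ from $u_2$ to $u_1$; * $\mathfrak V$ is *finitely generated*: it is $\infty$-generated by some finite set of vertices. Let $H$, the *minimum set of generators*, be the intersection of all sets of vertices that $1$-generate $\mathfrak V$. Then $H$ is finite, and the following holds for every choice of admissible paths $\gamma^v_u$ from $v$ to $u$ for $v,u\in H$. For $v\in H$ let $W_v\subseteq\bigoplus_{u\in H}V_u$ be the image of $V_v$ under $s\mapsto(\varphi_{\gamma^v_u}(s))_{u\in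 H}$. For $I\subseteq H$ let $\mu_v(I)$ be the dimension of the space of elements of $W_v$ whose components outside $I$ vanish, and let $\mu_v^*(I)=\mu_v(H)-\mu_v(H\setminus I)$. With $q(I)=\sum_{u\in I}q(u)$ for $q\in\mathbb R^H$, let $$P_v=\{q\in\mathbb R^H:\ \mu_v(I)\le q(I)\le\mu_v^*(I)\text{ for all }I\subseteq H\}$$ be the base polytope of the supermodular function $\mu_v$, and let $$\Omega_{r+1}=\{q\in\mathbb R^H:\ q(v)\ge 0\text{ for all }v\in H,\ q(H)=r+1\}.$$ Then the polytopes $P_v$ ($v\in H$) and their nonempty faces form a polyhedral tiling of $\Omega_{r+1}$: they form a finite collection of nonempty polytopes, closed under taking nonempty faces, any two members are disjoint or intersect in a common face of both, and the union of the collection is $\Omega_{r+1}$. In particular, $\bigcup_{v\in H}P_v=\Omega_{r+1}$. -/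

import Mathlib

universe u w x y

namespace LinkedNet

open Quiver

section Quivers

variable {Q : Type u} [Quiver.{w} Q] {n : ℕ}

/-- The type `t_γ` of a path `γ`: `typeCount ty γ t` is the number of arrows of type `t` in `γ`,
where `ty` assigns to each arrow its type, that is, its part in the partition of the arrow set. -/
def typeCount (ty : ∀ ⦃a b : Q⦄, (a ⟶ b) → Fin (n + 1)) {a : Q} :
    ∀ {b : Q}, Path a b → Fin (n + 1) → ℕ
  | _, Path.nil, _ => 0
  | _, Path.cons p e, t => typeCount ty p t + if ty e = t then 1 else 0

/-- A path is admissible if it avoids some arrow type. -/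
def IsAdmissible (ty : ∀ ⦃a b : Q⦄, (a ⟶ b) → Fin (n + 1)) {a b : Q} (γ : Path a b) : Prop :=
  ∃ t, typeCount ty γ t = 0

/-- A path is simple if it contains at most one arrow of each type. -/
def IsSimple (ty : ∀ ⦃a b : Q⦄, (a ⟶ b) → Fin (n + 1)) {a b : Q} (γ : Path a b) : Prop :=
  ∀ t, typeCount ty γ t ≤ 1

/-- `Q`, with the partition of its arrows into the `n + 1` parts given by `ty`,
is a `ℤⁿ`-quiver. -/
structure IsZnQuiver (ty : ∀ ⦃a b : Q⦄, (a ⟶ b) → Fin (n + 1)) : Prop where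
  /-- Exactly one arrow of each type leaves each vertex. -/
  existsUnique_arrow : ∀ (a : Q) (t : Fin (n + 1)), ∃! e : (b : Q) × (a ⟶ b), ty e.2 = t
  /-- Each vertex is connected to each other by an admissible path. -/
  exists_admissible : ∀ a b : Q, ∃ γ : Path a b, IsAdmissible ty γ
  /-- Two paths leaving the same vertex have the same end if and only if the difference of
  their types is a constant function. -/
  end_eq_iff : ∀ (a b c : Q) (γ : Path a b) (δ : Path a c),
    b = c ↔ ∃ d : ℤ, ∀ t, (typeCount ty γ t : ℤ) - (typeCount ty δ t : ℤ) = d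

/-- Two distinct vertices are neighbors if they are connected by a simple path. -/
def IsNeighbor (ty : ∀ ⦃a b : Q⦄, (a ⟶ b) → Fin (n + 1)) (a b : Q) : Prop :=
  a ≠ b ∧ ∃ γ : Path a b, IsSimple ty γ

end Quivers

section Representations

variable {k : Type x} [Field k] {Q : Type u} [Quiver.{w} Q] {n : ℕ}
  {V : Q → Type y} [∀ v, AddCommGroup (V v)] [∀ v, Module k (V v)]

/-- The composition `φ_γ` of the maps of a representation `(V, φ)` along a path `γ`. -/
def pathMap (φ : ∀ ⦃a b : Q⦄, (a ⟶ b) → (V a →ₗ[k] V b)) {a : Q} :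
    ∀ {b : Q}, Path a b → (V a →ₗ[k] V b)
  | _, Path.nil => LinearMap.id
  | _, Path.cons p e => φ e ∘ₗ pathMap φ p

/-- The representation is `m`-generated by the set `S` of vertices, `m ∈ ℕ ∪ {∞}`. -/
def IsGeneratedBy (φ : ∀ ⦃a b : Q⦄, (a ⟶ b) → (V a →ₗ[k] V b)) (m : ℕ∞) (S : Set Q) : Prop :=
  ∀ v : Q, ∃ l : ℕ, (l : ℕ∞) ≤ m ∧
    ∃ (z : Fin l → Q) (γ : ∀ i, Path (z i) v), (∀ i, z i ∈ S) ∧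
      Function.Surjective fun s : (∀ i, V (z i)) => ∑ i, pathMap φ (γ i) (s i)

/-- The representation is finitely generated: `∞`-generated by a finite set of vertices. -/
def IsFinitelyGenerated (φ : ∀ ⦃a b : Q⦄, (a ⟶ b) → (V a →ₗ[k] V b)) : Prop :=
  ∃ S : Set Q, S.Finite ∧ IsGeneratedBy φ ⊤ S

/-- The intersection of all sets of vertices that `1`-generate the representation. -/
def minimumGenerators (φ : ∀ ⦃a b : Q⦄, (a ⟶ b) → (V a →ₗ[k] V b)) : Set Q :=
  ⋂₀ {S : Set Q | IsGeneratedBy φ 1 S}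

/-- The representation is a linked net over the `ℤⁿ`-quiver `Q`. -/
structure IsLinkedNet (ty : ∀ ⦃a b : Q⦄, (a ⟶ b) → Fin (n + 1))
    (φ : ∀ ⦃a b : Q⦄, (a ⟶ b) → (V a →ₗ[k] V b)) : Prop where
  smul_of_admissible : ∀ (a b : Q) (γ₁ γ₂ : Path a b), IsAdmissible ty γ₂ →
    ∃ c : k, pathMap φ γ₁ = c • pathMap φ γ₂
  /-- Minimal circuits, that is, simple nonadmissible paths, act as zero. -/
  eq_zero_of_minimalCircuit : ∀ (a b : Q) (γ : Path a b), IsSimple ty γ → ¬ IsAdmissible ty γ →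
    pathMap φ γ = 0
  ker_inf_ker : ∀ (a b c : Q) (γ₁ : Path a b) (γ₂ : Path a c),
    IsAdmissible ty γ₁ → IsAdmissible ty γ₂ →
    (∀ t, typeCount ty γ₁ t = 0 ∨ typeCount ty γ₂ t = 0) →
    LinearMap.ker (pathMap φ γ₁) ⊓ LinearMap.ker (pathMap φ γ₂) = ⊥

/-- Exactness: `im φ^a_b = ker φ^b_a` for all neighbors `a` and `b`, where `φ^a_b` is the map of
any admissible path from `a` to `b`. -/
def IsExact (ty : ∀ ⦃a b : Q⦄, (a ⟶ b) → Fin (n + 1))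
    (φ : ∀ ⦃a b : Q⦄, (a ⟶ b) → (V a →ₗ[k] V b)) : Prop :=
  ∀ a b : Q, IsNeighbor ty a b → ∀ (γ : Path a b) (δ : Path b a),
    IsAdmissible ty γ → IsAdmissible ty δ →
    LinearMap.range (pathMap φ γ) = LinearMap.ker (pathMap φ δ)

/-- For a set `H` of vertices and paths `γ v u` from `v` to `u` for `v, u ∈ H`, the subspace `W_v`
of `⨁_{u ∈ H} V_u` consisting of the vectors `(φ_{γ v u}(s))_{u ∈ H}` for `s ∈ V_v`. -/
def subspaceW (φ : ∀ ⦃a b : Q⦄, (a ⟶ b) → (V a →ₗ[k] V b)) {H : Set Q}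
    (γ : ∀ v u : H, Path (v : Q) (u : Q)) (v : H) : Submodule k (∀ u : H, V u) :=
  LinearMap.range (LinearMap.pi fun u : H => pathMap φ (γ v u))

end Representations

section Polytopes

variable {H : Type u}

/-- The function `μ_W` of a subspace `W` of `⨁_{v ∈ H} U_v`: `μ_W(I)` is the dimension of the
subspace of all elements of `W` supported on `I`. -/
noncomputable def mu {k : Type x} [Field k] {U : H → Type y} [∀ v, AddCommGroup (U v)]
    [∀ v, Module k (U v)] (W : Submodule k (∀ v, U v)) (I : Finset H) : ℝ :=
  Module.finrank k ↥(W ⊓ Submodule.pi {v | v ∉ I} fun _ => (⊥ : Submodule k (U _)))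

variable [Fintype H]

open Classical in
/-- The adjoint `μ^*(I) = μ(H) - μ(H - I)` of a function `μ` on the subsets of `H`. -/
noncomputable def adjoint (μ : Finset H → ℝ) (I : Finset H) : ℝ :=
  μ Finset.univ - μ (Finset.univ \ I)

/-- The base polytope of `μ`. -/
def basePolytope (μ : Finset H → ℝ) : Set (H → ℝ) :=
  {q | ∀ I : Finset H, μ I ≤ ∑ v ∈ I, q v ∧ ∑ v ∈ I, q v ≤ adjoint μ I}

variable (H) in
/-- The standard simplex `Ω_d` in `ℝ^H`. -/
def Omega (d : ℝ) : Set (H → ℝ) :=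
  {q | (∀ v, 0 ≤ q v) ∧ ∑ v, q v = d}

/-- A polytope: a bounded intersection of finitely many closed half-spaces. -/
def IsPolytope (P : Set (H → ℝ)) : Prop :=
  Bornology.IsBounded P ∧
    ∃ S : Set (((H → ℝ) →ₗ[ℝ] ℝ) × ℝ), S.Finite ∧ P = {q | ∀ c ∈ S, c.1 q ≤ c.2}

/-- `F` is a (nonempty) face of `P`: the set of maximizers on `P` of a linear functional. The zero
functional shows that a nonempty `P` is a face of itself. -/
def IsFace (P F : Set (H → ℝ)) : Prop :=
  F.Nonempty ∧ ∃ l : (H → ℝ) →ₗ[ℝ] ℝ, F = {q ∈ P | ∀ p ∈ P, l p ≤ l q}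

/-- The collection `T` is a polyhedral tiling of `Ω`: a finite collection of nonempty polytopes,
closed under taking faces, any two of which are disjoint or intersect in a common face, and whose
union is `Ω`. -/
structure IsPolyhedralTiling (T : Set (Set (H → ℝ))) (Ω : Set (H → ℝ)) : Prop where
  finite : T.Finite
  nonempty : ∀ P ∈ T, P.Nonempty
  isPolytope : ∀ P ∈ T, IsPolytope P
  face_mem : ∀ P ∈ T, ∀ F, IsFace P F → F ∈ T
  inter : ∀ P ∈ T, ∀ P' ∈ T, P ∩ P' = ∅ ∨ (IsFace P (P ∩ P') ∧ IsFace P' (P ∩ P'))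
  sUnion_eq : ⋃₀ T = Ω

end Polytopes

end LinkedNet

/-!
Fix a base vertex `a`. The types of the admissible paths that leave `a` are coordinates that
identify the vertices with `ℤⁿ⁺¹ / ℤ(1, …, 1)`. Write `K_v(s)` for the kernel of the map along a
path of type `s` that leaves `v` (`typeKer`). The polytopes `P_v` are the domains of linearity of a
minimum of finitely many affine functions of `q`, so they form a regular subdivision of the simplex.

*The potential.* By exactness, the dimensions of the kernels of the arrows along a simple path add
up to the dimension of the kernel along the path (`IsExact.pathLen_eq_finrank`). Exchanging two
consecutive arrows of a path therefore does not change the sum of these dimensions, which thus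
depends only on the start and the type of the path (`IsLinkedNet.pathLen_eq_of_typeCount_eq`), and
each full circuit contributes `r + 1`. Summing along the paths from `a` gives a function `D` on the
vertices. For `q` in the simplex put `F_q(v) = ∑ h, q(h) max(v - h) - D(v)`, where `max` is the
largest coordinate (`height`). As `q(H) = r + 1`, increments of `F_q` along paths are well defined,
and along a path of type `e_J` the increment is
`q({h : some type in J is not used by admissible paths v → h}) - dim K_v(e_J)`.

*Base polytopes are minimum loci.* In a linked net `K_v(s) ∩ K_v(t) = K_v(min(s, t))`, and `K_v(s)`
depends only on the support of `s`, for admissible types. The defining inequalities of `P_v` thus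
say that `F_q` does not decrease along the simple paths that leave `v`. Since `F_q` is discretely
convex, this makes `v` a global minimum (`height_le_of_forall_simple`); the convexity of `-D` comes
from the injectivity of an admissible path on kernels along paths of disjoint types
(`IsLinkedNet.finrank_typeKer_le`). So `q ∈ P_v` if and only if `v` minimizes `F_q`
(`mem_basePolytope_mu_iff_height`). As `F_q(v)` is affine in `q`, `P_v ∩ P_u` is cut out in `P_v` by
an affine function that attains its bound there, and is a common face.

*Covering.* The relation "some path from `v` to `u` acts surjectively" is a partial order, and
`F_q` is monotone for it, because `D` is constant along such a path. A set `1`-generates if and only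
if every vertex lies above one of its elements. Finite generation by `S` gives a finite
`1`-generating set: a vertex `v` such that all admissible paths from `S` to `v` use an arrow type
lies above the source of the arrow of that type that arrives at `v`, and only finitely many vertices
are not of this kind. Hence the minimal vertices are finite in number and `1`-generate; they form
`H`, and `F_q` attains its minimum on `H`.

The remaining part is about polytopes only: each has finitely many faces, and a face of a face is a
face (`IsFace.trans`), because a polytope is the convex hull of finitely many points.
-/

namespace LinkedNet

open Quiver

/-! ### Faces of polytopes -/

section Faces

variable {H : Type u} {P E F G : Set (H → ℝ)}

theorem IsFace.subset (h : IsFace P F) : F ⊆ P := by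
  obtain ⟨-, l, rfl⟩ := h
  exact fun q hq => hq.1

theorem isFace_self (h : P.Nonempty) : IsFace P P := ⟨h, 0, by simp⟩

/-- The points of `P` where an upper bound of a linear functional is attained form a face. -/
theorem isFace_of_forall_le {l : (H → ℝ) →ₗ[ℝ] ℝ} {c : ℝ} (hl : ∀ q ∈ P, l q ≤ c)
    (hF : F = {q ∈ P | l q = c}) (hne : F.Nonempty) : IsFace P F := by
  refine ⟨hne, l, ?_⟩
  obtain ⟨p, hp⟩ := hne
  rw [hF] at hp ⊢
  ext q
  refine and_congr_right fun hq => ⟨fun h p hp => h ▸ hl p hp, fun h => ?_⟩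
  exact le_antisymm (hl q hq) (hp.2 ▸ h p hp.1)

theorem IsFace.of_subset (h : IsFace P F) (hF : F ⊆ E) (hE : E ⊆ P) : IsFace E F := by
  obtain ⟨⟨f, hf⟩, l, hl⟩ := h
  refine ⟨⟨f, hf⟩, l, ?_⟩
  ext q
  refine ⟨fun hq => ⟨hF hq, fun p hp => ?_⟩, fun hq => ?_⟩
  · rw [hl] at hq
    exact hq.2 p (hE hp)
  · have hle := hq.2 f (hF hf)
    rw [hl] at hf ⊢
    exact ⟨hE hq.1, fun p hp => (hf.2 p hp).trans hle⟩

theorem IsFace.inter (hF : IsFace P F) (hG : IsFace P G) (hne : (F ∩ G).Nonempty) :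
    IsFace P (F ∩ G) := by
  obtain ⟨-, l, rfl⟩ := hF
  obtain ⟨-, m, rfl⟩ := hG
  obtain ⟨p, hp₁, hp₂⟩ := hne
  refine isFace_of_forall_le (l := l + m) (c := l p + m p)
    (fun q hq => add_le_add (hp₁.2 q hq) (hp₂.2 q hq)) ?_ ⟨p, hp₁, hp₂⟩
  ext q
  constructor
  · rintro ⟨h₁, h₂⟩
    refine ⟨h₁.1, ?_⟩
    have := h₁.2 p hp₁.1
    have := h₂.2 p hp₁.1
    have := hp₁.2 q h₁.1
    have := hp₂.2 q h₁.1
    simp only [LinearMap.add_apply]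
    linarith
  · rintro ⟨hq, h⟩
    simp only [LinearMap.add_apply] at h
    have h₁ := hp₁.2 q hq
    have h₂ := hp₂.2 q hq
    refine ⟨⟨hq, fun s hs => (hp₁.2 s hs).trans ?_⟩, ⟨hq, fun s hs => (hp₂.2 s hs).trans ?_⟩⟩ <;>
      linarith

theorem IsPolytope.of_isFace (h : IsPolytope P) (hF : IsFace P F) : IsPolytope F := by
  refine ⟨h.1.subset hF.subset, ?_⟩
  obtain ⟨-, S, hS, hP⟩ := h
  obtain ⟨⟨f, hf⟩, l, hl⟩ := hF
  refine ⟨insert (-l, -l f) S, hS.insert _, ?_⟩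
  rw [hl] at hf
  ext q
  rw [hl]
  simp only [Set.mem_insert_iff, forall_eq_or_imp, LinearMap.neg_apply, neg_le_neg_iff,
    Set.mem_ofPred_eq]
  rw [hP] at hf ⊢
  exact ⟨fun hq => ⟨hq.2 f hf.1, hq.1⟩, fun hq => ⟨hq.2, fun p hp => (hf.2 p hp).trans hq.1⟩⟩

/-- A point of a convex hull where a linear functional attains an upper bound is a convex
combination of generators where it does. -/
theorem mem_convexHull_filter {A : Finset (H → ℝ)} {l : (H → ℝ) →ₗ[ℝ] ℝ} {c : ℝ}
    (hA : ∀ a ∈ A, l a ≤ c) {q : H → ℝ} (hq : q ∈ convexHull ℝ (A : Set (H → ℝ)))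
    (hc : l q = c) : q ∈ convexHull ℝ {a | a ∈ A ∧ l a = c} := by
  obtain ⟨w, hw₀, hw₁, hwq⟩ := Finset.mem_convexHull'.1 hq
  have hsum : ∑ a ∈ A, w a * (c - l a) = 0 := by
    have : l q = ∑ a ∈ A, w a * l a := by
      rw [← hwq, map_sum]
      simp
    simp only [mul_sub, Finset.sum_sub_distrib, ← Finset.sum_mul, hw₁]
    linarith
  have hzero := (Finset.sum_eq_zero_iff_of_nonneg fun a ha =>
    mul_nonneg (hw₀ a ha) (sub_nonneg.2 (hA a ha))).1 hsum
  have hzero' : ∀ a ∈ A, w a ≠ 0 → l a = c := fun a ha hne =>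
    (sub_eq_zero.1 ((mul_eq_zero.1 (hzero a ha)).resolve_left hne)).symm
  classical
  have : {a | a ∈ A ∧ l a = c} = ((A.filter fun a => l a = c : Finset (H → ℝ)) : Set (H → ℝ)) := by
    ext a; simp
  rw [this, Finset.mem_convexHull']
  refine ⟨w, fun a ha => hw₀ a (Finset.mem_filter.1 ha).1, ?_, ?_⟩
  · rw [← hw₁]
    exact Finset.sum_filter_of_ne hzero'
  · rw [← hwq]
    exact Finset.sum_filter_of_ne fun a ha hne => hzero' a ha fun h => hne (by simp [h])

theorem le_of_mem_convexHull {A : Set (H → ℝ)} {l : (H → ℝ) →ₗ[ℝ] ℝ} {c : ℝ}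
    (hA : ∀ a ∈ A, l a ≤ c) {q : H → ℝ} (hq : q ∈ convexHull ℝ A) : l q ≤ c :=
  convexHull_min (fun a ha => hA a ha) (convex_halfSpace_le l.isLinear c) hq

theorem eq_of_mem_convexHull {A : Set (H → ℝ)} {l : (H → ℝ) →ₗ[ℝ] ℝ} {c : ℝ}
    (hA : ∀ a ∈ A, l a = c) {q : H → ℝ} (hq : q ∈ convexHull ℝ A) : l q = c :=
  convexHull_min (fun a ha => hA a ha) (convex_hyperplane l.isLinear c) hq

variable [Fintype H]

/-- Two extreme points at which the same defining inequalities are tight coincide: otherwise the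
first could be moved a little both ways along the line that joins them. -/
theorem IsPolytope.finite_extremePoints (h : IsPolytope P) : (P.extremePoints ℝ).Finite := by
  obtain ⟨-, S, hS, rfl⟩ := h
  refine Set.Finite.of_injOn (f := fun q => {c ∈ S | c.1 q = c.2})
    (t := S.powerset) (fun q _ => Set.sep_subset _ _) ?_ hS.finite_subsets
  intro p hp q hq hpq
  by_contra hne
  have htight : ∀ c ∈ S, c.1 p = c.2 → c.1 q = c.2 := fun c hc h => by
    have : c ∈ {c ∈ S | c.1 p = c.2} := ⟨hc, h⟩
    exact ((Set.ext_iff.1 hpq c).1 this).2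
  have hev : ∀ᶠ ε : ℝ in nhdsWithin 0 (Set.Ioi 0), ∀ c ∈ S,
      c.1 (p + ε • (p - q)) ≤ c.2 ∧ c.1 (p - ε • (p - q)) ≤ c.2 := by
    rw [Filter.eventually_all_finite hS]
    intro c hc
    rcases (hp.1 c hc).lt_or_eq with hlt | heq
    · have h1 : Filter.Tendsto (fun ε : ℝ => c.1 p + ε * (c.1 p - c.1 q))
          (nhdsWithin 0 (Set.Ioi 0)) (nhds (c.1 p + 0 * (c.1 p - c.1 q))) :=
        (Continuous.tendsto (by fun_prop) 0).mono_left nhdsWithin_le_nhds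
      have h2 : Filter.Tendsto (fun ε : ℝ => c.1 p - ε * (c.1 p - c.1 q))
          (nhdsWithin 0 (Set.Ioi 0)) (nhds (c.1 p - 0 * (c.1 p - c.1 q))) :=
        (Continuous.tendsto (by fun_prop) 0).mono_left nhdsWithin_le_nhds
      filter_upwards [h1.eventually_lt_const (by simpa using hlt),
        h2.eventually_lt_const (by simpa using hlt)] with ε h1 h2
      simp only [map_add, map_sub, map_smul, smul_eq_mul]
      exact ⟨h1.le, h2.le⟩
    · refine Filter.Eventually.of_forall fun ε => ?_
      simp only [map_add, map_sub, map_smul, smul_eq_mul, heq, htight c hc heq]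
      simp
  obtain ⟨ε, hε, hpos⟩ := (hev.and self_mem_nhdsWithin).exists
  have hmem : p ∈ openSegment ℝ (p + ε • (p - q)) (p - ε • (p - q)) := by
    refine ⟨1 / 2, 1 / 2, by norm_num, by norm_num, by norm_num, ?_⟩
    ext i
    simp
    ring
  have := hp.2 (fun c hc => (hε c hc).1) (fun c hc => (hε c hc).2) hmem
  rw [add_eq_left, smul_eq_zero, sub_eq_zero] at this
  exact this.elim (ne_of_gt hpos) hne

theorem IsPolytope.exists_eq_convexHull (h : IsPolytope P) :
    ∃ A : Finset (H → ℝ), P = convexHull ℝ (A : Set (H → ℝ)) := by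
  have hfin := h.finite_extremePoints
  obtain ⟨hb, S, hS, hP⟩ := h
  have hP' : P = ⋂ c ∈ S, {q | c.1 q ≤ c.2} := by
    rw [hP]; ext q; simp
  have hclosed : IsClosed P := by
    rw [hP']
    exact isClosed_biInter fun c _ =>
      isClosed_le (LinearMap.continuous_of_finiteDimensional c.1) continuous_const
  have hconv : Convex ℝ P := by
    rw [hP']
    exact convex_iInter₂ fun c _ => convex_halfSpace_le c.1.isLinear _
  refine ⟨hfin.toFinset, ?_⟩
  rw [hfin.coe_toFinset, ← (Set.Finite.isClosed_convexHull ℝ hfin).closure_eq,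
    closure_convexHull_extremePoints (Metric.isCompact_of_isClosed_isBounded hclosed hb) hconv]

/-- A face of a face of a polytope is a face: if the functionals `l` and `m` cut out `F` in `P` and
`G` in `F`, then `M • l + m` cuts out `G` in `P` for `M` large with respect to the vertices. -/
theorem IsFace.trans (hP : IsPolytope P) (hF : IsFace P F) (hG : IsFace F G) : IsFace P G := by
  obtain ⟨A, hA⟩ := hP.exists_eq_convexHull
  have hFP := hF.subset
  obtain ⟨-, l, hl⟩ := hF
  obtain ⟨⟨g, hg⟩, m, hm⟩ := hG
  have hgF : g ∈ F := (hm ▸ hg).1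
  have hlg : ∀ p ∈ P, l p ≤ l g := (hl ▸ hgF).2
  have hmg : ∀ p ∈ F, m p ≤ m g := (hm ▸ hg).2
  have hmemF : ∀ p ∈ P, l p = l g → p ∈ F := fun p hp h => by
    rw [hl]; exact ⟨hp, fun s hs => h ▸ hlg s hs⟩
  have hAP : ∀ a ∈ A, a ∈ P := fun a ha => hA ▸ subset_convexHull ℝ _ ha
  obtain ⟨M, hM⟩ : ∃ M : ℝ, ∀ a ∈ A, l a < l g → m a - m g < M * (l g - l a) := by
    obtain ⟨M, hM⟩ := (A.finite_toSet.image fun a => (m a - m g) / (l g - l a)).bddAbove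
    refine ⟨M + 1, fun a ha hlt => ?_⟩
    have := hM ⟨a, ha, rfl⟩
    rw [← div_lt_iff₀ (sub_pos.2 hlt)]
    linarith
  have hle : ∀ a ∈ A, (M • l + m) a ≤ M * l g + m g := fun a ha => by
    simp only [LinearMap.add_apply, LinearMap.smul_apply, smul_eq_mul]
    rcases (hlg a (hAP a ha)).lt_or_eq with hlt | heq
    · linarith [hM a ha hlt]
    · rw [heq]
      linarith [hmg a (hmemF a (hAP a ha) heq)]
  refine isFace_of_forall_le (l := M • l + m) (c := M * l g + m g)
    (fun q hq => le_of_mem_convexHull hle (hA ▸ hq)) ?_ ⟨g, hg⟩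
  ext q
  constructor
  · intro hq
    have hqF : q ∈ F := (hm ▸ hq).1
    refine ⟨hFP hqF, ?_⟩
    have h₁ : l q = l g := le_antisymm (hlg q (hFP hqF)) ((hl ▸ hqF).2 g (hFP hgF))
    have h₂ : m q = m g := le_antisymm (hmg q hqF) ((hm ▸ hq).2 g hgF)
    simp [h₁, h₂]
  · rintro ⟨hqP, hq⟩
    have hmem := mem_convexHull_filter hle (hA ▸ hqP) hq
    have hl' : ∀ a ∈ {a | a ∈ A ∧ (M • l + m) a = M * l g + m g}, l a = l g := by
      rintro a ⟨ha, heq⟩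
      by_contra hne
      have := hM a ha (lt_of_le_of_ne (hlg a (hAP a ha)) hne)
      simp only [LinearMap.add_apply, LinearMap.smul_apply, smul_eq_mul] at heq
      linarith
    have hlq := eq_of_mem_convexHull hl' hmem
    have hmq : m q = m g := by
      simp only [LinearMap.add_apply, LinearMap.smul_apply, smul_eq_mul, hlq] at hq
      linarith
    rw [hm]
    exact ⟨hmemF q hqP hlq, fun p hp => hmq ▸ hmg p hp⟩

theorem IsPolytope.finite_faces (hP : IsPolytope P) : {F | IsFace P F}.Finite := by
  obtain ⟨A, hA⟩ := hP.exists_eq_convexHull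
  have hface : ∀ F, IsFace P F → F = convexHull ℝ ((A : Set (H → ℝ)) ∩ F) := by
    intro F hF
    obtain ⟨⟨f, hf⟩, l, hl⟩ := hF
    have hlf : ∀ p ∈ P, l p ≤ l f := (hl ▸ hf).2
    have hset : ∀ q, q ∈ F ↔ q ∈ P ∧ l q = l f := fun q => by
      rw [hl]
      exact and_congr_right fun hq => ⟨fun h => le_antisymm (hlf q hq) (h f (hl ▸ hf).1),
        fun h p hp => h ▸ hlf p hp⟩
    have hAP : ∀ a ∈ A, a ∈ P := fun a ha => hA ▸ subset_convexHull ℝ _ ha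
    ext q
    constructor
    · intro hq
      obtain ⟨hqP, hq⟩ := (hset q).1 hq
      have := mem_convexHull_filter (fun a ha => hlf a (hAP a ha)) (hA ▸ hqP) hq
      refine convexHull_mono ?_ this
      exact fun a ha => ⟨ha.1, (hset a).2 ⟨hAP a ha.1, ha.2⟩⟩
    · intro hq
      refine (hset q).2 ⟨?_, eq_of_mem_convexHull (fun a ha => ((hset a).1 ha.2).2) hq⟩
      rw [hA]
      exact convexHull_mono Set.inter_subset_left hq
  refine Set.Finite.of_injOn (f := fun F => (A : Set (H → ℝ)) ∩ F)
    (t := (A : Set (H → ℝ)).powerset) (fun F _ => Set.inter_subset_left) ?_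
    A.finite_toSet.finite_subsets
  intro F hF G hG h
  rw [hface F hF, hface G hG]
  exact congrArg _ h

/-- Finitely many polytopes that meet pairwise in common faces form, with their faces, a
polyhedral tiling of their union. -/
theorem isPolyhedralTiling_faces {ι : Type*} [Finite ι] {P : ι → Set (H → ℝ)}
    (hP : ∀ i, IsPolytope (P i)) (hne : ∀ i, (P i).Nonempty)
    (hinter : ∀ i j, (P i ∩ P j).Nonempty → IsFace (P i) (P i ∩ P j)) :
    IsPolyhedralTiling {F | ∃ i, F = P i ∨ IsFace (P i) F} (⋃ i, P i) := by
  have hT : {F | ∃ i, F = P i ∨ IsFace (P i) F} = ⋃ i, {F | IsFace (P i) F} := by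
    ext F
    simp only [Set.mem_ofPred_eq, Set.mem_iUnion]
    refine exists_congr fun i => ⟨?_, Or.inr⟩
    rintro (rfl | h)
    exacts [isFace_self (hne i), h]
  -- The face `P i ∩ P j` of both tiles mediates between their faces.
  have key : ∀ i j F G, IsFace (P i) F → IsFace (P j) G → (F ∩ G).Nonempty →
      IsFace F (F ∩ G) := by
    intro i j F G hF hG hFG
    obtain ⟨p, hpF, hpG⟩ := hFG
    have hpE : p ∈ P i ∩ P j := ⟨hF.subset hpF, hG.subset hpG⟩
    have hE := hinter i j ⟨p, hpE⟩
    have hE' : IsFace (P j) (P i ∩ P j) := by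
      rw [Set.inter_comm]
      exact hinter j i ⟨p, hpE.2, hpE.1⟩
    have h₁ : IsFace (P i ∩ P j) (F ∩ (P i ∩ P j)) :=
      (hF.inter hE ⟨p, hpF, hpE⟩).of_subset Set.inter_subset_right hE.subset
    have h₂ : IsFace (P i ∩ P j) (G ∩ (P i ∩ P j)) :=
      (hG.inter hE' ⟨p, hpG, hpE⟩).of_subset Set.inter_subset_right hE'.subset
    have h₃ := h₁.inter h₂ ⟨p, ⟨hpF, hpE⟩, ⟨hpG, hpE⟩⟩
    have heq : F ∩ (P i ∩ P j) ∩ (G ∩ (P i ∩ P j)) = F ∩ G := by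
      ext q
      have := fun h : q ∈ F => hF.subset h
      have := fun h : q ∈ G => hG.subset h
      simp only [Set.mem_inter_iff]
      tauto
    rw [heq] at h₃
    exact (hE.trans (hP i) h₃).of_subset Set.inter_subset_left hF.subset
  rw [hT]
  refine ⟨Set.finite_iUnion fun i => (hP i).finite_faces, ?_, ?_, ?_, ?_, ?_⟩
  · rintro F ⟨-, ⟨i, rfl⟩, hF⟩
    exact hF.1
  · rintro F ⟨-, ⟨i, rfl⟩, hF⟩
    exact (hP i).of_isFace hF
  · rintro F ⟨-, ⟨i, rfl⟩, hF⟩ G hG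
    exact Set.mem_iUnion.2 ⟨i, IsFace.trans (hP i) hF hG⟩
  · rintro F ⟨-, ⟨i, rfl⟩, hF⟩ G ⟨-, ⟨j, rfl⟩, hG⟩
    rw [or_iff_not_imp_left, ← ne_eq, ← Set.nonempty_iff_ne_empty]
    intro h
    refine ⟨key i j F G hF hG h, ?_⟩
    rw [Set.inter_comm] at h ⊢
    exact key j i G F hG hF h
  · ext q
    simp only [Set.mem_sUnion, Set.mem_iUnion]
    exact ⟨fun ⟨F, ⟨i, hF⟩, hq⟩ => ⟨i, hF.subset hq⟩,
      fun ⟨i, hq⟩ => ⟨P i, ⟨i, isFace_self (hne i)⟩, hq⟩⟩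

end Faces

/-! ### Paths in a `ℤⁿ`-quiver -/

section Paths

variable {Q : Type u} [Quiver.{w} Q] {n : ℕ} {ty : ∀ ⦃a b : Q⦄, (a ⟶ b) → Fin (n + 1)}

theorem typeCount_comp {a b c : Q} (p : Path a b) (q : Path b c) (t : Fin (n + 1)) :
    typeCount ty (p.comp q) t = typeCount ty p t + typeCount ty q t := by
  induction q with
  | nil => simp [typeCount]
  | cons q e ih => simp [typeCount, ih, add_assoc]

theorem typeCount_toPath {a b : Q} (e : a ⟶ b) (t : Fin (n + 1)) :
    typeCount ty e.toPath t = if ty e = t then 1 else 0 := by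
  simp [Hom.toPath, typeCount]

/-- The characteristic function of a set of arrow types, as a type of paths. -/
def ind (J : Finset (Fin (n + 1))) (t : Fin (n + 1)) : ℕ := if t ∈ J then 1 else 0

theorem ind_le_one (J : Finset (Fin (n + 1))) (t : Fin (n + 1)) : ind J t ≤ 1 := by
  unfold ind; split <;> simp

namespace IsZnQuiver

variable (hQ : IsZnQuiver ty)
include hQ

theorem end_eq_of_typeCount_eq {a b c : Q} {γ : Path a b} {δ : Path a c}
    (h : typeCount ty γ = typeCount ty δ) : b = c :=
  (hQ.end_eq_iff a b c γ δ).2 ⟨0, fun t => by simp [h]⟩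

theorem end_eq_of_add {a b c : Q} {γ : Path a b} {δ : Path a c} (m : ℕ)
    (h : ∀ t, typeCount ty γ t = typeCount ty δ t + m) : b = c :=
  (hQ.end_eq_iff a b c γ δ).2 ⟨m, fun t => by simp [h]⟩

theorem typeCount_eq_of_isAdmissible {a b : Q} {γ δ : Path a b} (hγ : IsAdmissible ty γ)
    (hδ : IsAdmissible ty δ) : typeCount ty γ = typeCount ty δ := by
  obtain ⟨d, hd⟩ := (hQ.end_eq_iff a b b γ δ).1 rfl
  obtain ⟨i, hi⟩ := hγ
  obtain ⟨j, hj⟩ := hδ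
  ext t
  have h₁ := hd i
  have h₂ := hd j
  have h₃ := hd t
  omega

/-- The type of a path with the same ends as an admissible path exceeds the type of the latter by a
nonnegative constant. -/
theorem exists_eq_add {a b : Q} (γ : Path a b) {δ : Path a b} (hδ : IsAdmissible ty δ) :
    ∃ m : ℕ, ∀ t, typeCount ty γ t = typeCount ty δ t + m := by
  obtain ⟨d, hd⟩ := (hQ.end_eq_iff a b b γ δ).1 rfl
  obtain ⟨j, hj⟩ := hδ
  refine ⟨d.toNat, fun t => ?_⟩
  have h₁ := hd j
  have h₂ := hd t
  omega

theorem exists_path_typeCount_eq (a : Q) (s : Fin (n + 1) → ℕ) :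
    ∃ b, ∃ γ : Path a b, typeCount ty γ = s := by
  induction hN : ∑ t, s t generalizing s with
  | zero =>
    refine ⟨a, Path.nil, ?_⟩
    ext t
    exact ((Finset.sum_eq_zero_iff.1 hN) t (Finset.mem_univ t)).symm
  | succ N ih =>
    obtain ⟨i, -, hi⟩ := Finset.exists_ne_zero_of_sum_ne_zero (hN.trans_ne N.succ_ne_zero)
    have hle : Pi.single i 1 ≤ s := by
      intro t
      by_cases h : t = i
      · subst h; simpa [Nat.one_le_iff_ne_zero] using hi
      · simp [h]
    obtain ⟨b, γ, hγ⟩ := ih (s - Pi.single i 1) (by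
      have : ∑ t, s t = ∑ t, (s - Pi.single i 1 : Fin (n + 1) → ℕ) t +
          ∑ t, (Pi.single i 1 : Fin (n + 1) → ℕ) t := by
        rw [← Finset.sum_add_distrib]
        exact Finset.sum_congr rfl fun t _ => (Nat.sub_add_cancel (hle t)).symm
      rw [Finset.sum_pi_single'] at this
      simp only [Finset.mem_univ, if_true] at this
      omega)
    obtain ⟨⟨c, e⟩, he, -⟩ := hQ.existsUnique_arrow b i
    refine ⟨c, γ.cons e, ?_⟩
    ext t
    simp only at he
    have := hle t
    simp only [typeCount, hγ, he, Pi.sub_apply]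
    by_cases h : t = i
    · subst h; simp at this ⊢; omega
    · simp [h, Ne.symm h]

/-- A path can be replaced by one of the same type whose initial part has any given smaller type. -/
theorem exists_factor {a b : Q} (γ : Path a b) (s s' : Fin (n + 1) → ℕ)
    (h : ∀ t, typeCount ty γ t = s t + s' t) :
    ∃ c, ∃ (γ₁ : Path a c) (γ₂ : Path c b), typeCount ty γ₁ = s ∧ typeCount ty γ₂ = s' := by
  obtain ⟨c, γ₁, h₁⟩ := hQ.exists_path_typeCount_eq a s
  obtain ⟨b', γ₂, h₂⟩ := hQ.exists_path_typeCount_eq c s'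
  obtain rfl : b = b' := hQ.end_eq_of_typeCount_eq (γ := γ) (δ := γ₁.comp γ₂) (by
    ext t; rw [typeCount_comp, h, h₁, h₂])
  exact ⟨c, γ₁, γ₂, h₁, h₂⟩

/-- A path of type at most one can be completed to a closed path with one arrow of each type. -/
theorem exists_complement {a b : Q} (γ : Path a b) (hγ : IsSimple ty γ) :
    ∃ δ : Path b a, ∀ t, typeCount ty γ t + typeCount ty δ t = 1 := by
  obtain ⟨c, δ, hδ⟩ := hQ.exists_path_typeCount_eq b fun t => 1 - typeCount ty γ t
  have h : ∀ t, typeCount ty γ t + typeCount ty δ t = 1 := fun t => by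
    have := hγ t
    rw [hδ]
    beta_reduce
    omega
  obtain rfl : c = a := hQ.end_eq_of_add (γ := γ.comp δ) (δ := Path.nil) 1
    (fun t => by rw [typeCount_comp, h]; simp [typeCount])
  exact ⟨δ, h⟩

theorem eq_nil_of_isAdmissible {a : Q} (γ : Path a a) (hγ : IsAdmissible ty γ) : γ = Path.nil := by
  have h := hQ.typeCount_eq_of_isAdmissible hγ (δ := Path.nil) ⟨0, rfl⟩
  cases γ with
  | nil => rfl
  | cons p e => simpa [typeCount] using congrFun h (ty e)

theorem eq_of_cons {a b c : Q} {e : a ⟶ b} {f : a ⟶ c} (h : ty e = ty f) :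
    (⟨b, e⟩ : (b : Q) × (a ⟶ b)) = ⟨c, f⟩ :=
  (hQ.existsUnique_arrow a (ty f)).unique h rfl

end IsZnQuiver

end Paths

/-! ### Kernels and dimensions along paths of a linked net -/

section Kernels

variable {k : Type x} [Field k] {Q : Type u} [Quiver.{w} Q] {n r : ℕ}
  {ty : ∀ ⦃a b : Q⦄, (a ⟶ b) → Fin (n + 1)}
  {V : Q → Type y} [∀ v, AddCommGroup (V v)] [∀ v, Module k (V v)]
  {φ : ∀ ⦃a b : Q⦄, (a ⟶ b) → (V a →ₗ[k] V b)}

theorem pathMap_comp {a b c : Q} (p : Path a b) (q : Path b c) :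
    pathMap φ (p.comp q) = pathMap φ q ∘ₗ pathMap φ p := by
  induction q with
  | nil => simp [pathMap]
  | cons q e ih => simp [pathMap, ih, LinearMap.comp_assoc]

theorem pathMap_toPath {a b : Q} (e : a ⟶ b) : pathMap φ e.toPath = φ e := by
  simp [Hom.toPath, pathMap]

namespace IsLinkedNet

variable (hV : IsLinkedNet ty φ) (hQ : IsZnQuiver ty)
include hV

theorem ker_eq_ker {a b : Q} {γ δ : Path a b} (hγ : IsAdmissible ty γ) (hδ : IsAdmissible ty δ) :
    LinearMap.ker (pathMap φ γ) = LinearMap.ker (pathMap φ δ) := by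
  have key : ∀ γ δ : Path a b, IsAdmissible ty δ →
      LinearMap.ker (pathMap φ δ) ≤ LinearMap.ker (pathMap φ γ) := fun γ δ hδ s hs => by
    obtain ⟨c, hc⟩ := hV.smul_of_admissible a b γ δ hδ
    rw [LinearMap.mem_ker] at hs ⊢
    rw [hc, LinearMap.smul_apply, hs, smul_zero]
  exact le_antisymm (key δ γ hγ) (key γ δ hδ)

theorem range_le_range {a b : Q} (γ : Path a b) {δ : Path a b} (hδ : IsAdmissible ty δ) :
    LinearMap.range (pathMap φ γ) ≤ LinearMap.range (pathMap φ δ) := by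
  obtain ⟨c, hc⟩ := hV.smul_of_admissible a b γ δ hδ
  rintro _ ⟨s, rfl⟩
  exact ⟨c • s, by rw [hc, map_smul, LinearMap.smul_apply]⟩

include hQ

/-- Up to a scalar, a nonadmissible path can be rearranged so as to contain a minimal circuit. -/
theorem pathMap_eq_zero {a b : Q} (γ : Path a b) (h : ¬ IsAdmissible ty γ) :
    pathMap φ γ = 0 := by
  have hpos : ∀ t, 0 < typeCount ty γ t := fun t => Nat.pos_of_ne_zero fun h0 => h ⟨t, h0⟩
  induction γ with
  | nil => exact absurd (hpos 0) (by simp [typeCount])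
  | @cons b' c p e ih =>
    by_cases hp : IsAdmissible ty p
    · obtain ⟨i, hi⟩ := hp
      have hei : ty e = i := by
        by_contra hne
        have := hpos i
        simp [typeCount, hi, hne] at this
      obtain ⟨d, p₁, p₂, h₁, h₂⟩ := hQ.exists_factor p
        (fun t => typeCount ty p t - if t = i then 0 else 1) (fun t => if t = i then 0 else 1)
        (fun t => by
          have := hpos t
          simp only [typeCount, hei] at this
          by_cases ht : t = i
          · simp [ht]
          · simp [Ne.symm ht] at this
            simp [ht]
            omega)
      have h₁₂ : IsAdmissible ty (p₁.comp p₂) := ⟨i, by rw [typeCount_comp, h₁, h₂]; simp [hi]⟩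
      obtain ⟨c', hc'⟩ := hV.smul_of_admissible a b' p _ h₁₂
      have hcirc : ∀ t, typeCount ty (p₂.cons e) t = 1 := fun t => by
        simp only [typeCount, h₂, hei]
        by_cases ht : t = i
        · simp [ht]
        · simp [ht, Ne.symm ht]
      have := hV.eq_zero_of_minimalCircuit d c (p₂.cons e) (fun t => (hcirc t).le)
        (fun ⟨t, ht⟩ => by simp [hcirc] at ht)
      simp only [pathMap] at this ⊢
      rw [hc', pathMap_comp, LinearMap.comp_smul, ← LinearMap.comp_assoc, this]
      simp
    · simp [pathMap, ih hp fun t => Nat.pos_of_ne_zero fun h0 => hp ⟨t, h0⟩]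

theorem ker_eq_of_typeCount_eq {a b c : Q} {γ : Path a b} {δ : Path a c}
    (h : typeCount ty γ = typeCount ty δ) :
    LinearMap.ker (pathMap φ γ) = LinearMap.ker (pathMap φ δ) := by
  obtain rfl := hQ.end_eq_of_typeCount_eq h
  by_cases hγ : IsAdmissible ty γ
  · exact hV.ker_eq_ker hγ (by obtain ⟨t, ht⟩ := hγ; exact ⟨t, h ▸ ht⟩)
  · rw [hV.pathMap_eq_zero hQ γ hγ, hV.pathMap_eq_zero hQ δ
      (fun ⟨t, ht⟩ => hγ ⟨t, by rw [h]; exact ht⟩)]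

end IsLinkedNet

/-- The kernel `K_a(s)` of the map along a path of type `s` that leaves `a`, for the path given by
choice; in a linked net it does not depend on the choice. -/
noncomputable def typeKer (hQ : IsZnQuiver ty)
    (φ : ∀ ⦃a b : Q⦄, (a ⟶ b) → (V a →ₗ[k] V b)) (a : Q) (s : Fin (n + 1) → ℕ) :
    Submodule k (V a) :=
  LinearMap.ker (pathMap φ (hQ.exists_path_typeCount_eq a s).choose_spec.choose)

namespace IsLinkedNet

variable (hV : IsLinkedNet ty φ) (hQ : IsZnQuiver ty)
include hV

theorem ker_eq_typeKer {a b : Q} (γ : Path a b) :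
    LinearMap.ker (pathMap φ γ) = typeKer hQ φ a (typeCount ty γ) :=
  hV.ker_eq_of_typeCount_eq hQ
    (hQ.exists_path_typeCount_eq a (typeCount ty γ)).choose_spec.choose_spec.symm

theorem typeKer_mono (a : Q) {s t : Fin (n + 1) → ℕ} (h : ∀ i, s i ≤ t i) :
    typeKer hQ φ a s ≤ typeKer hQ φ a t := by
  obtain ⟨b, γ, rfl⟩ := hQ.exists_path_typeCount_eq a s
  obtain ⟨c, δ, hδ⟩ := hQ.exists_path_typeCount_eq b fun i => t i - typeCount ty γ i
  have : t = typeCount ty (γ.comp δ) := by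
    ext i
    have := h i
    rw [typeCount_comp, hδ]
    beta_reduce
    omega
  rw [this, ← hV.ker_eq_typeKer, ← hV.ker_eq_typeKer, pathMap_comp]
  exact LinearMap.ker_le_ker_comp _ _

theorem typeKer_eq_top (a : Q) {s : Fin (n + 1) → ℕ} (h : ∀ i, s i ≠ 0) :
    typeKer hQ φ a s = ⊤ := by
  obtain ⟨b, γ, rfl⟩ := hQ.exists_path_typeCount_eq a s
  rw [← hV.ker_eq_typeKer, hV.pathMap_eq_zero hQ γ fun ⟨i, hi⟩ => h i hi, LinearMap.ker_zero]

theorem typeKer_zero (a : Q) : typeKer hQ φ a 0 = ⊥ := by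
  have : (0 : Fin (n + 1) → ℕ) = typeCount ty (Path.nil : Path a a) := rfl
  rw [this, ← hV.ker_eq_typeKer]
  exact LinearMap.ker_id

theorem mem_typeKer_add {a b : Q} (γ : Path a b) {s : Fin (n + 1) → ℕ} {x : V a} :
    x ∈ typeKer hQ φ a (fun i => typeCount ty γ i + s i) ↔
      pathMap φ γ x ∈ typeKer hQ φ b s := by
  obtain ⟨c, δ, rfl⟩ := hQ.exists_path_typeCount_eq b s
  have : (fun i => typeCount ty γ i + typeCount ty δ i) = typeCount ty (γ.comp δ) := by
    ext i; rw [typeCount_comp]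
  rw [this, ← hV.ker_eq_typeKer, ← hV.ker_eq_typeKer, pathMap_comp]
  rfl

theorem eq_zero_of_mem_typeKer {a : Q} {s t : Fin (n + 1) → ℕ} (hs : ∃ i, s i = 0)
    (ht : ∃ i, t i = 0) (h : ∀ i, s i = 0 ∨ t i = 0) {x : V a} (hxs : x ∈ typeKer hQ φ a s)
    (hxt : x ∈ typeKer hQ φ a t) : x = 0 := by
  obtain ⟨b, γ, rfl⟩ := hQ.exists_path_typeCount_eq a s
  obtain ⟨c, δ, rfl⟩ := hQ.exists_path_typeCount_eq a t
  rw [← hV.ker_eq_typeKer] at hxs hxt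
  have := hV.ker_inf_ker a b c γ δ hs ht h
  exact (Submodule.mem_bot k).1 (this ▸ Submodule.mem_inf.2 ⟨hxs, hxt⟩)

/-- An element killed along two admissible paths is killed along their common part, as its image
under the common part is killed along the two disjoint remainders. -/
theorem mem_typeKer_inf {a : Q} {s t : Fin (n + 1) → ℕ} (hs : ∃ i, s i = 0)
    (ht : ∃ i, t i = 0) {x : V a} (hxs : x ∈ typeKer hQ φ a s) (hxt : x ∈ typeKer hQ φ a t) :
    x ∈ typeKer hQ φ a (s ⊓ t) := by
  obtain ⟨b, γ, hγ⟩ := hQ.exists_path_typeCount_eq a (s ⊓ t)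
  have hs' : s = fun i => typeCount ty γ i + (s i - (s ⊓ t) i) := by
    ext i; simp [hγ]
  have ht' : t = fun i => typeCount ty γ i + (t i - (s ⊓ t) i) := by
    ext i; simp [hγ]
  rw [hs', hV.mem_typeKer_add] at hxs
  rw [ht', hV.mem_typeKer_add] at hxt
  rw [← hγ, ← hV.ker_eq_typeKer, LinearMap.mem_ker]
  refine hV.eq_zero_of_mem_typeKer hQ ?_ ?_ ?_ hxs hxt
  · obtain ⟨i, hi⟩ := hs; exact ⟨i, by simp [hi]⟩
  · obtain ⟨i, hi⟩ := ht; exact ⟨i, by simp [hi]⟩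
  · intro i
    simp only [Pi.inf_apply]
    rcases le_total (s i) (t i) with h | h <;> simp [h]

/-- The kernel along an admissible path depends only on the set of arrow types of the path:
after one arrow of each of these types, the remainder of the path and the completion of the first
part to a circuit have no type in common, and the element is killed along both. -/
theorem typeKer_le_support (a : Q) {s : Fin (n + 1) → ℕ} (hs : ∃ i, s i = 0) :
    typeKer hQ φ a s ≤ typeKer hQ φ a (ind (Finset.univ.filter fun i => s i ≠ 0)) := by
  intro x hx
  by_cases h0 : s = 0
  · rw [h0, hV.typeKer_zero, Submodule.mem_bot] at hx
    rw [hx]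
    exact zero_mem _
  obtain ⟨j, hj⟩ := Function.ne_iff.1 h0
  obtain ⟨b, γ, hγ⟩ := hQ.exists_path_typeCount_eq a (ind (Finset.univ.filter fun i => s i ≠ 0))
  have hγi : ∀ i, typeCount ty γ i = if s i = 0 then 0 else 1 := fun i => by
    rw [hγ]; simp [ind]
  have h₁ : s = fun i => typeCount ty γ i + (s i - typeCount ty γ i) := by
    ext i
    rw [hγi]
    split <;> omega
  rw [h₁, hV.mem_typeKer_add] at hx
  rw [← hγ, ← hV.ker_eq_typeKer, LinearMap.mem_ker]
  obtain ⟨i, hi⟩ := hs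
  refine hV.eq_zero_of_mem_typeKer hQ (t := fun i => if s i = 0 then 1 else 0)
    ⟨i, by simp [hi]⟩ ⟨j, if_neg hj⟩ (fun l => ?_) hx ?_
  · rw [hγi]
    by_cases hl : s l = 0 <;> simp [hl]
  · rw [← hV.mem_typeKer_add, hV.typeKer_eq_top hQ a fun l => ?_]
    · trivial
    · rw [hγi]
      by_cases hl : s l = 0 <;> simp [hl]

variable [∀ v, FiniteDimensional k (V v)]

theorem finrank_typeKer_le {a b : Q} (γ : Path a b) {s : Fin (n + 1) → ℕ}
    (hγ : IsAdmissible ty γ) (hs : ∃ i, s i = 0) (h : ∀ i, typeCount ty γ i = 0 ∨ s i = 0) :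
    Module.finrank k (typeKer hQ φ a s) ≤ Module.finrank k (typeKer hQ φ b s) := by
  have hmap : ∀ x ∈ typeKer hQ φ a s, pathMap φ γ x ∈ typeKer hQ φ b s := fun x hx => by
    rw [← hV.mem_typeKer_add]
    exact hV.typeKer_mono hQ a (fun i => Nat.le_add_left _ _) hx
  refine LinearMap.finrank_le_finrank_of_injective (f := (pathMap φ γ).restrict hmap) ?_
  rw [← LinearMap.ker_eq_bot, LinearMap.ker_eq_bot']
  rintro ⟨x, hx⟩ h0
  have h0' : pathMap φ γ x = 0 := congrArg Subtype.val h0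
  rw [← LinearMap.mem_ker, hV.ker_eq_typeKer hQ] at h0'
  exact Subtype.ext (hV.eq_zero_of_mem_typeKer hQ hγ hs h h0' hx)

end IsLinkedNet

/-- The sum of the dimensions of the kernels of the maps of the arrows of a path. -/
noncomputable def pathLen (φ : ∀ ⦃a b : Q⦄, (a ⟶ b) → (V a →ₗ[k] V b)) {a : Q} :
    ∀ {b : Q}, Path a b → ℕ
  | _, Path.nil => 0
  | _, Path.cons p e => pathLen φ p + Module.finrank k (LinearMap.ker (φ e))

theorem pathLen_comp {a b c : Q} (p : Path a b) (q : Path b c) :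
    pathLen φ (p.comp q) = pathLen φ p + pathLen φ q := by
  induction q with
  | nil => simp [pathLen]
  | cons q e ih => simp [pathLen, ih, add_assoc]

theorem finrank_ker_comp {A B C : Type*} [AddCommGroup A] [Module k A] [FiniteDimensional k A]
    [AddCommGroup B] [Module k B] [FiniteDimensional k B] [AddCommGroup C] [Module k C]
    (f : A →ₗ[k] B) (g : B →ₗ[k] C) (h : LinearMap.ker g ≤ LinearMap.range f) :
    Module.finrank k (LinearMap.ker (g ∘ₗ f)) =
      Module.finrank k (LinearMap.ker f) + Module.finrank k (LinearMap.ker g) := by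
  have h₁ := LinearMap.finrank_range_add_finrank_ker
    (f.domRestrict (LinearMap.ker (g ∘ₗ f)))
  have h₂ : LinearMap.range (f.domRestrict (LinearMap.ker (g ∘ₗ f))) = LinearMap.ker g := by
    ext y
    constructor
    · rintro ⟨⟨x, hx⟩, rfl⟩
      exact hx
    · intro hy
      obtain ⟨x, rfl⟩ := h hy
      exact ⟨⟨x, hy⟩, rfl⟩
  have h₃ : Module.finrank k (LinearMap.ker (f.domRestrict (LinearMap.ker (g ∘ₗ f)))) =
      Module.finrank k (LinearMap.ker f) := by
    rw [LinearMap.ker_domRestrict]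
    exact (Submodule.comapSubtypeEquivOfLe (LinearMap.ker_le_ker_comp f g)).finrank_eq
  rw [h₂, h₃] at h₁
  omega

/-- By exactness, `ker φ_e` is the image of a path that completes `e` to a minimal circuit, and
such a path can be chosen to end in `p`. -/
theorem IsExact.ker_le_range (hexact : IsExact ty φ) (hQ : IsZnQuiver ty) {a b c : Q}
    (p : Path a b) (e : b ⟶ c) (h : IsSimple ty (p.cons e)) :
    LinearMap.ker (φ e) ≤ LinearMap.range (pathMap φ p) := by
  have hp : typeCount ty p (ty e) = 0 := by
    have := h (ty e)
    simp only [typeCount, if_true] at this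
    omega
  by_cases hbc : b = c
  · subst hbc
    -- A loop arises only if there is a single arrow type.
    obtain ⟨m, hm⟩ := hQ.exists_eq_add e.toPath (δ := Path.nil) ⟨0, rfl⟩
    have hm1 : m = 1 := by
      have := hm (ty e)
      simpa [typeCount_toPath, typeCount] using this.symm
    cases p with
    | nil => simp [pathMap]
    | cons p f =>
      have h₁ := hm (ty f)
      simp only [typeCount_toPath, typeCount, hm1] at h₁
      have h₂ : ty e = ty f := by
        by_contra hne
        simp [hne] at h₁
      simp [typeCount, h₂] at hp
  · obtain ⟨δ, hδ⟩ := hQ.exists_complement _ h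
    have hδp : ∀ t, typeCount ty e.toPath t + typeCount ty (δ.comp p) t = 1 := fun t => by
      have := hδ t
      simp only [typeCount] at this
      rw [typeCount_comp, typeCount_toPath]
      omega
    have hadm₁ : IsAdmissible ty e.toPath := by
      by_contra hna
      refine hbc (hQ.end_eq_of_add (γ := e.toPath) (δ := Path.nil) 1 fun t => ?_).symm
      have h₁ := hδp t
      have h₂ : typeCount ty e.toPath t ≠ 0 := fun h0 => hna ⟨t, h0⟩
      simp only [typeCount]
      omega
    have hadm₂ : IsAdmissible ty (δ.comp p) := ⟨ty e, by
      have := hδp (ty e)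
      rw [typeCount_toPath, if_pos rfl] at this
      omega⟩
    have := hexact c b ⟨Ne.symm hbc, δ.comp p, fun t => by have := hδp t; omega⟩ _ _ hadm₂ hadm₁
    rw [pathMap_toPath] at this
    rw [← this, pathMap_comp]
    exact LinearMap.range_comp_le_range _ _

theorem IsExact.pathLen_eq_finrank [∀ v, FiniteDimensional k (V v)] (hexact : IsExact ty φ)
    (hQ : IsZnQuiver ty) {a b : Q} (γ : Path a b) (h : IsSimple ty γ) :
    pathLen φ γ = Module.finrank k (LinearMap.ker (pathMap φ γ)) := by
  induction γ with
  | @nil => rw [show pathMap φ (Path.nil : Path a a) = LinearMap.id from rfl, LinearMap.ker_id,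
      finrank_bot, pathLen]
  | cons p e ih =>
    rw [show pathMap φ (p.cons e) = φ e ∘ₗ pathMap φ p from rfl, pathLen,
      ih fun t => le_trans (by simp [typeCount]) (h t),
      finrank_ker_comp _ _ (hexact.ker_le_range hQ p e h)]

namespace IsLinkedNet

variable (hV : IsLinkedNet ty φ) (hQ : IsZnQuiver ty) (hexact : IsExact ty φ)
  [∀ v, FiniteDimensional k (V v)]
include hV hQ hexact

/-- `pathLen` depends only on the type of a path: exchanging two consecutive arrows does not change
it, since the two arrows form a simple path. -/
theorem pathLen_eq_of_typeCount_eq {a b c : Q} (γ : Path a b) (δ : Path a c)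
    (h : typeCount ty γ = typeCount ty δ) : pathLen φ γ = pathLen φ δ := by
  induction hN : ∑ t, typeCount ty γ t generalizing b c with
  | zero =>
    have h0 : ∀ t, typeCount ty γ t = 0 := fun t =>
      (Finset.sum_eq_zero_iff.1 hN) t (Finset.mem_univ t)
    cases γ with
    | cons p e => simpa [typeCount] using h0 (ty e)
    | nil =>
      cases δ with
      | nil => rfl
      | cons p e =>
        have := h0 (ty e)
        rw [h] at this
        simp [typeCount] at this
  | succ N ih =>
    cases γ with
    | nil => simp [typeCount] at hN
    | @cons b' _ p e =>
      cases δ with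
      | nil => exact absurd (congrFun h (ty e)) (by simp [typeCount])
      | @cons c' _ q f =>
        have hpN : ∑ t, typeCount ty p t = N := by
          simp only [typeCount, Finset.sum_add_distrib, Finset.sum_ite_eq, Finset.mem_univ,
            if_true] at hN
          omega
        have hqN : ∑ t, typeCount ty q t = N := by
          rw [h] at hN
          simp only [typeCount, Finset.sum_add_distrib, Finset.sum_ite_eq, Finset.mem_univ,
            if_true] at hN
          omega
        by_cases hef : ty e = ty f
        · have hpq : typeCount ty p = typeCount ty q := by
            ext t
            have := congrFun h t
            simp only [typeCount, hef] at this
            omega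
          obtain rfl := hQ.end_eq_of_typeCount_eq hpq
          obtain ⟨rfl, hef'⟩ := Sigma.mk.inj (hQ.eq_of_cons hef)
          obtain rfl := eq_of_heq hef'
          simp only [pathLen, ih p q hpq hpN]
        · -- Both `p` and `q` are compared with paths through the end of a common part `σ`.
          have hle : ∀ t, (if ty f = t then 1 else 0) ≤ typeCount ty p t := fun t => by
            have := congrFun h t
            simp only [typeCount] at this
            split_ifs at this ⊢ <;> omega
          obtain ⟨m, σ, τ, hσ, hτ⟩ := hQ.exists_factor p
            (fun t => typeCount ty p t - if ty f = t then 1 else 0)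
            (fun t => if ty f = t then 1 else 0) (fun t => by have := hle t; omega)
          obtain ⟨d, τ', hτ'⟩ := hQ.exists_path_typeCount_eq m fun t => if ty e = t then 1 else 0
          have h₁ : pathLen φ p = pathLen φ (σ.comp τ) := ih p _ (by
            ext t
            rw [typeCount_comp, hσ, hτ]
            have := hle t
            beta_reduce
            omega) hpN
          have hqt : typeCount ty q = typeCount ty (σ.comp τ') := by
            ext t
            rw [typeCount_comp, hσ, hτ']
            have h₁ := hle t
            have h₂ := congrFun h t
            simp only [typeCount] at h₂
            beta_reduce
            omega
          have h₂ : pathLen φ q = pathLen φ (σ.comp τ') := ih q _ hqt hqN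
          obtain rfl := hQ.end_eq_of_typeCount_eq hqt
          have hs₁ : IsSimple ty (τ.cons e) := fun t => by
            simp only [typeCount, hτ]
            split_ifs <;> omega
          have hs₂ : IsSimple ty (τ'.cons f) := fun t => by
            simp only [typeCount, hτ']
            split_ifs <;> omega
          have h₃ : pathLen φ (τ.cons e) = pathLen φ (τ'.cons f) := by
            rw [hexact.pathLen_eq_finrank hQ _ hs₁, hexact.pathLen_eq_finrank hQ _ hs₂,
              hV.ker_eq_of_typeCount_eq hQ]
            ext t
            simp only [typeCount, hτ, hτ']
            omega
          simp only [pathLen] at h₃ ⊢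
          rw [h₁, h₂, pathLen_comp, pathLen_comp]
          omega

/-- Each full circuit contributes the dimension of the spaces to `pathLen`. -/
theorem pathLen_eq_add_mul (hdim : ∀ v : Q, Module.finrank k (V v) = r + 1) {a b c : Q}
    (γ : Path a b) (δ : Path a c) (m : ℕ)
    (h : ∀ t, typeCount ty γ t = typeCount ty δ t + m) :
    pathLen φ γ = pathLen φ δ + m * (r + 1) := by
  induction m generalizing b c with
  | zero =>
    rw [hV.pathLen_eq_of_typeCount_eq hQ hexact γ δ (by ext t; simpa using h t)]
    simp
  | succ m ih =>
    obtain ⟨d, ε, hε⟩ := hQ.exists_path_typeCount_eq c fun _ => 1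
    have h₁ := ih γ (δ.comp ε) fun t => by
      rw [typeCount_comp, hε, h]
      ring
    have h₂ : pathLen φ ε = r + 1 := by
      rw [hexact.pathLen_eq_finrank hQ ε (fun t => by rw [hε]),
        hV.pathMap_eq_zero hQ ε (fun ⟨t, ht⟩ => by simp [hε] at ht), LinearMap.ker_zero,
        finrank_top, hdim]
    rw [h₁, pathLen_comp, h₂]
    ring

end IsLinkedNet

end Kernels

/-! ### Coordinates on the vertices -/

section Types

variable {Q : Type u} [Quiver.{w} Q] {n : ℕ} {ty : ∀ ⦃a b : Q⦄, (a ⟶ b) → Fin (n + 1)}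

/-- The type of the admissible paths from `a` to `b`. The functions `hQ.admType a` are coordinates
on the set of vertices, which they identify with `ℤⁿ⁺¹ / ℤ(1, …, 1)`. -/
noncomputable def IsZnQuiver.admType (hQ : IsZnQuiver ty) (a b : Q) : Fin (n + 1) → ℕ :=
  typeCount ty (hQ.exists_admissible a b).choose

namespace IsZnQuiver

variable (hQ : IsZnQuiver ty)

theorem exists_admType_eq_zero (a b : Q) : ∃ i, hQ.admType a b i = 0 :=
  (hQ.exists_admissible a b).choose_spec

theorem typeCount_eq_admType {a b : Q} {γ : Path a b} (hγ : IsAdmissible ty γ) :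
    typeCount ty γ = hQ.admType a b :=
  hQ.typeCount_eq_of_isAdmissible hγ (hQ.exists_admissible a b).choose_spec

theorem admType_injective (a : Q) : Function.Injective (hQ.admType a) := fun _ _ h =>
  hQ.end_eq_of_typeCount_eq h

theorem exists_typeCount_eq_admType_add {a b : Q} (γ : Path a b) :
    ∃ m : ℕ, ∀ t, typeCount ty γ t = hQ.admType a b t + m :=
  hQ.exists_eq_add γ (hQ.exists_admissible a b).choose_spec

/-- `admType` is additive along paths, up to a constant. -/
theorem exists_admType_add (a : Q) {b c : Q} (γ : Path b c) :
    ∃ m : ℕ, ∀ t, hQ.admType a b t + typeCount ty γ t = hQ.admType a c t + m := by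
  obtain ⟨m, hm⟩ := hQ.exists_typeCount_eq_admType_add ((hQ.exists_admissible a b).choose.comp γ)
  refine ⟨m, fun t => ?_⟩
  rw [← hm, typeCount_comp]
  rfl

/-- The set of vertices `v` such that for no arrow type do all admissible paths from `S` to `v`
use that type: a lattice analogue of the tropical convex hull of `S`. -/
def tropicalHull (S : Set Q) : Set Q := {v | ∀ i, ∃ z ∈ S, hQ.admType z v i = 0}

theorem finite_tropicalHull {S : Set Q} (hS : S.Finite) : (hQ.tropicalHull S).Finite := by
  rcases isEmpty_or_nonempty Q with hE | ⟨⟨a⟩⟩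
  · exact Set.toFinite _
  obtain ⟨C, hC⟩ : ∃ C : ℕ, ∀ z ∈ S, ∀ i, hQ.admType a z i ≤ C := by
    obtain ⟨C, hC⟩ := (hS.image (hQ.admType a)).bddAbove
    refine ⟨∑ i, C i, fun z hz i => (hC ⟨z, hz, rfl⟩ i).trans ?_⟩
    exact Finset.single_le_sum (fun _ _ => Nat.zero_le _) (Finset.mem_univ i)
  refine Set.Finite.of_injOn (t := Set.Iic fun _ => C) ?_ (hQ.admType_injective a).injOn
    (Set.finite_Iic _)
  intro v hv i
  obtain ⟨z, hz, hzi⟩ := hv i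
  obtain ⟨m, hm⟩ := hQ.exists_admType_add a (hQ.exists_admissible z v).choose
  obtain ⟨j, hj⟩ := hQ.exists_admType_eq_zero a v
  have h₁ := hm i
  have h₂ := hC z hz i
  change hQ.admType a z i + hQ.admType z v i = _ at h₁
  change hQ.admType a v i ≤ C
  omega

/-- If all admissible paths from `z` to `v` use an arrow type, then they can be rearranged to end
in the arrow of that type that arrives at `v`. -/
theorem exists_arrow_to (v : Q) (i : Fin (n + 1)) :
    ∃ u, ∃ e : u ⟶ v, ty e = i ∧ ∀ z : Q, hQ.admType z v i ≠ 0 →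
      (∀ t, hQ.admType z v t = hQ.admType z u t + if i = t then 1 else 0) := by
  obtain ⟨u, ε, hε⟩ := hQ.exists_path_typeCount_eq v fun t => if i = t then 0 else 1
  obtain ⟨⟨v', e⟩, he, -⟩ := hQ.existsUnique_arrow u i
  simp only at he
  obtain rfl : v' = v := hQ.end_eq_of_add (γ := ε.cons e) (δ := Path.nil) 1 fun t => by
    simp only [typeCount, hε, he]
    split_ifs <;> omega
  refine ⟨u, e, he, fun z hz t => ?_⟩
  obtain ⟨m, hm⟩ := hQ.exists_admType_add z e.toPath
  obtain ⟨j, hj⟩ := hQ.exists_admType_eq_zero z u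
  obtain ⟨l, hl⟩ := hQ.exists_admType_eq_zero z v'
  simp only [typeCount_toPath, he] at hm
  have h₁ := hm j
  have h₂ := hm l
  have h₃ := hm i
  have h₄ := hm t
  have hil : i ≠ l := fun h => hz (h ▸ hl)
  simp only [if_neg hil, if_true] at h₂ h₃
  have hm0 : m = 0 := by
    by_cases hij : i = j
    · subst hij
      omega
    · simp only [if_neg hij] at h₁
      omega
  omega

end IsZnQuiver

end Types

/-! ### The minimum set of generators -/

section Generators

theorem nontrivial_of_finrank {k : Type*} [Field k] {ι : Type*} {V : ι → Type*}
    [∀ v, AddCommGroup (V v)] [∀ v, Module k (V v)] {r : ℕ}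
    (hdim : ∀ v, Module.finrank k (V v) = r + 1) (v : ι) : Nontrivial (V v) :=
  Module.nontrivial_of_finrank_pos (R := k) (by rw [hdim]; omega)

variable {k : Type x} [Field k] {Q : Type u} [Quiver.{w} Q] {n r : ℕ}
  {ty : ∀ ⦃a b : Q⦄, (a ⟶ b) → Fin (n + 1)}
  {V : Q → Type y} [∀ v, AddCommGroup (V v)] [∀ v, Module k (V v)]
  {φ : ∀ ⦃a b : Q⦄, (a ⟶ b) → (V a →ₗ[k] V b)}

/-- `V_a` generates `V_b`: the map along some path from `a` to `b` is surjective. For a linked net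
with spaces of the same positive dimension this is a partial order on the vertices. -/
def Generates (φ : ∀ ⦃a b : Q⦄, (a ⟶ b) → (V a →ₗ[k] V b)) (a b : Q) : Prop :=
  ∃ γ : Path a b, Function.Surjective (pathMap φ γ)

theorem Generates.refl (a : Q) : Generates φ a a := ⟨Path.nil, fun s => ⟨s, rfl⟩⟩

theorem Generates.trans {a b c : Q} (h : Generates φ a b) (h' : Generates φ b c) :
    Generates φ a c := by
  obtain ⟨γ, hγ⟩ := h
  obtain ⟨δ, hδ⟩ := h'
  exact ⟨γ.comp δ, by rw [pathMap_comp]; exact hδ.comp hγ⟩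

variable (hV : IsLinkedNet ty φ) (hQ : IsZnQuiver ty)
  (hdim : ∀ v : Q, Module.finrank k (V v) = r + 1)

include hV hQ hdim in
theorem isAdmissible_of_surjective {a b : Q} {γ : Path a b}
    (h : Function.Surjective (pathMap φ γ)) : IsAdmissible ty γ := by
  by_contra hna
  rw [hV.pathMap_eq_zero hQ γ hna] at h
  have := nontrivial_of_finrank hdim b
  obtain ⟨s, hs⟩ := exists_ne (0 : V b)
  obtain ⟨s', hs'⟩ := h s
  exact hs hs'.symm

include hV hQ hdim in
theorem Generates.antisymm {a b : Q} (h : Generates φ a b) (h' : Generates φ b a) : a = b := by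
  obtain ⟨γ, hγ⟩ := h
  obtain ⟨δ, hδ⟩ := h'
  have hs : Function.Surjective (pathMap φ (γ.comp δ)) := by
    rw [pathMap_comp]; exact hδ.comp hγ
  have hnil := hQ.eq_nil_of_isAdmissible _ (isAdmissible_of_surjective hV hQ hdim hs)
  refine (hQ.end_eq_of_typeCount_eq (γ := Path.nil) (δ := γ) ?_)
  ext t
  have := typeCount_comp (ty := ty) γ δ t
  rw [hnil] at this
  simp only [typeCount] at this ⊢
  omega

include hdim in
theorem isGeneratedBy_one_iff {S : Set Q} :
    IsGeneratedBy φ 1 S ↔ ∀ v, ∃ z ∈ S, Generates φ z v := by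
  refine forall_congr' fun v => ⟨?_, ?_⟩
  · rintro ⟨l, hl, z, γ, hz, hs⟩
    have hl' : l ≤ 1 := by exact_mod_cast hl
    interval_cases l
    · have := nontrivial_of_finrank hdim v
      obtain ⟨s, hs0⟩ := exists_ne (0 : V v)
      obtain ⟨s', hs'⟩ := hs s
      exact absurd (hs'.symm.trans (by simp)) hs0
    · refine ⟨z 0, hz 0, γ 0, fun s => ?_⟩
      obtain ⟨s', hs'⟩ := hs s
      exact ⟨s' 0, by simpa using hs'⟩
  · rintro ⟨z, hz, γ, hγ⟩
    refine ⟨1, le_rfl, fun _ => z, fun _ => γ, fun _ => hz, fun s => ?_⟩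
    obtain ⟨s', hs'⟩ := hγ s
    exact ⟨fun _ => s', by simpa using hs'⟩

include hV in
/-- A vertex outside the tropical hull of a generating set is generated by the source of one of its
incoming arrows, through which all admissible paths from the generating set can be made to pass;
the source is closer to the generating set. -/
theorem exists_mem_tropicalHull_generates
    (hdim : ∀ v : Q, Module.finrank k (V v) = r + 1) {S : Set Q}
    (hS : IsGeneratedBy φ ⊤ S) (v : Q) : ∃ b ∈ hQ.tropicalHull S, Generates φ b v := by
  obtain ⟨z₀, hz₀⟩ : S.Nonempty := by
    obtain ⟨l, -, z, γ, hz, hs⟩ := hS v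
    rcases Nat.eq_zero_or_pos l with rfl | hl
    · have := nontrivial_of_finrank hdim v
      obtain ⟨s, hs0⟩ := exists_ne (0 : V v)
      obtain ⟨s', hs'⟩ := hs s
      exact absurd (hs'.symm.trans (by simp)) hs0
    · exact ⟨z ⟨0, hl⟩, hz _⟩
  induction hN : ∑ t, hQ.admType z₀ v t using Nat.strong_induction_on generalizing v with
  | _ N ih =>
    by_cases hv : v ∈ hQ.tropicalHull S
    · exact ⟨v, hv, Generates.refl v⟩
    obtain ⟨i, hi⟩ : ∃ i, ∀ z ∈ S, hQ.admType z v i ≠ 0 := by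
      simpa [IsZnQuiver.tropicalHull] using hv
    obtain ⟨u, e, he, hu⟩ := hQ.exists_arrow_to v i
    have hsum := hu z₀ (hi z₀ hz₀)
    obtain ⟨b, hb, hbu⟩ := ih (∑ t, hQ.admType z₀ u t) (by
      rw [← hN, Finset.sum_congr rfl fun t _ => hsum t, Finset.sum_add_distrib]
      simp) u rfl
    refine ⟨b, hb, hbu.trans ⟨e.toPath, ?_⟩⟩
    rw [← LinearMap.range_eq_top, eq_top_iff]
    intro s _
    obtain ⟨l, -, z, γ, hz, hs⟩ := hS v
    obtain ⟨s', rfl⟩ := hs s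
    refine Submodule.sum_mem _ fun j _ => ?_
    obtain ⟨δ, hδ⟩ := hQ.exists_admissible (z j) u
    have hadm : IsAdmissible ty (δ.comp e.toPath) := by
      obtain ⟨l, hl⟩ := hQ.exists_admType_eq_zero (z j) v
      refine ⟨l, ?_⟩
      rw [typeCount_comp, typeCount_toPath, hQ.typeCount_eq_admType hδ, he,
        ← hu _ (hi _ (hz j)), hl]
    have := hV.range_le_range (γ j) hadm ⟨s' j, rfl⟩
    rw [pathMap_comp] at this
    exact LinearMap.range_comp_le_range _ _ this

include hV hQ hdim

/-- The intersection of all `1`-generating sets consists of the minimal vertices for `Generates`.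
It is finite and `1`-generates because some finite set does. -/
theorem minimumGenerators_finite_and_generates (hfg : IsFinitelyGenerated φ) :
    (minimumGenerators φ).Finite ∧ ∀ v, ∃ z ∈ minimumGenerators φ, Generates φ z v := by
  obtain ⟨S, hS, hgen⟩ := hfg
  have hB := hQ.finite_tropicalHull hS
  have hBgen := exists_mem_tropicalHull_generates hV hQ hdim hgen
  refine ⟨hB.subset (Set.sInter_subset_of_mem ((isGeneratedBy_one_iff hdim).2 hBgen)), ?_⟩
  intro v
  let po : PartialOrder Q :=
    { le := Generates φ
      le_refl := Generates.refl
      le_trans := fun _ _ _ => Generates.trans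
      le_antisymm := fun _ _ => Generates.antisymm hV hQ hdim }
  obtain ⟨b, hb, hbv⟩ := hBgen v
  obtain ⟨m, hmb, hm⟩ := hB.exists_le_minimal hb
  refine ⟨m, ?_, Generates.trans hmb hbv⟩
  rintro S' hS'
  obtain ⟨z, hz, hzm⟩ := (isGeneratedBy_one_iff hdim).1 hS' m
  obtain ⟨b', hb', hbz⟩ := hBgen z
  have hmb' : Generates φ m b' := hm.2 hb' (Generates.trans hbz hzm)
  obtain rfl : z = m := Generates.antisymm hV hQ hdim hzm (Generates.trans hmb' hbz)
  exact hz

end Generators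

/-! ### The largest coordinate of a difference -/

section MaxDiff

variable {n : ℕ} {s t A : Fin (n + 1) → ℕ}

/-- The largest coordinate of `s - A`. -/
def maxDiff (s A : Fin (n + 1) → ℕ) : ℤ :=
  Finset.univ.sup' Finset.univ_nonempty fun i => (s i : ℤ) - A i

theorem le_maxDiff (s A : Fin (n + 1) → ℕ) (i : Fin (n + 1)) : (s i : ℤ) - A i ≤ maxDiff s A :=
  Finset.le_sup' (fun i => (s i : ℤ) - A i) (Finset.mem_univ i)

theorem exists_maxDiff_eq (s A : Fin (n + 1) → ℕ) : ∃ i, maxDiff s A = (s i : ℤ) - A i := by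
  obtain ⟨i, -, hi⟩ := Finset.exists_mem_eq_sup' Finset.univ_nonempty
    fun i => (s i : ℤ) - A i
  exact ⟨i, hi⟩

theorem maxDiff_add_eq {B : Fin (n + 1) → ℕ} {c : ℤ}
    (h : ∀ i, (s i : ℤ) - A i + c = (t i : ℤ) - B i) : maxDiff s A + c = maxDiff t B := by
  obtain ⟨i, hi⟩ := exists_maxDiff_eq s A
  obtain ⟨j, hj⟩ := exists_maxDiff_eq t B
  have h₁ := le_maxDiff t B i
  have h₂ := le_maxDiff s A j
  have h₃ := h i
  have h₄ := h j
  omega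

theorem maxDiff_zero (hA : ∃ i, A i = 0) : maxDiff 0 A = 0 := by
  obtain ⟨i, hi⟩ := exists_maxDiff_eq 0 A
  obtain ⟨j, hj⟩ := hA
  have := le_maxDiff 0 A j
  simp only [Pi.zero_apply] at hi this
  omega

theorem maxDiff_ind (J : Finset (Fin (n + 1))) (hA : ∃ i, A i = 0) :
    maxDiff (ind J) A = if ∃ i ∈ J, A i = 0 then 1 else 0 := by
  obtain ⟨i, hi⟩ := exists_maxDiff_eq (ind J) A
  obtain ⟨j, hj⟩ := hA
  have h₁ := le_maxDiff (ind J) A j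
  split_ifs with h
  · obtain ⟨l, hl, hl0⟩ := h
    have h₂ := le_maxDiff (ind J) A l
    have h₃ := ind_le_one J i
    simp only [ind, if_pos hl] at h₂
    omega
  · push Not at h
    have h₂ : ind J i ≤ A i := by
      unfold ind
      split_ifs with hiJ
      · exact Nat.one_le_iff_ne_zero.2 (h i hiJ)
      · exact Nat.zero_le _
    omega

/-- Adding the characteristic function of `J` increases `maxDiff · A` at least as much when it is
done last, completing `t`, as when it is done first, if `t` is largest on `J`. -/
theorem maxDiff_ind_add_le (J : Finset (Fin (n + 1))) (hA : ∃ i, A i = 0)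
    (ht : ∀ i, t i = s i + ind J i) (hJ : ∀ i ∈ J, ∀ j, s j + 1 ≤ t i) :
    maxDiff (ind J) A + maxDiff s A ≤ maxDiff t A := by
  rw [maxDiff_ind J hA]
  obtain ⟨j, hj⟩ := exists_maxDiff_eq s A
  split_ifs with h
  · obtain ⟨i, hi, hi0⟩ := h
    have h₁ := le_maxDiff t A i
    have h₂ := hJ i hi j
    omega
  · have h₁ := le_maxDiff t A j
    have h₂ := ht j
    omega

end MaxDiff

/-! ### Discrete convexity of the height -/

section Height

variable {k : Type x} [Field k] {Q : Type u} [Quiver.{w} Q] {n r : ℕ}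
  {ty : ∀ ⦃a b : Q⦄, (a ⟶ b) → Fin (n + 1)}
  {V : Q → Type y} [∀ v, AddCommGroup (V v)] [∀ v, Module k (V v)]
  {φ : ∀ ⦃a b : Q⦄, (a ⟶ b) → (V a →ₗ[k] V b)}

/-- The value of `pathLen` on the admissible paths from the base vertex `a` to `v`. -/
noncomputable def potential (hQ : IsZnQuiver ty) (φ : ∀ ⦃a b : Q⦄, (a ⟶ b) → (V a →ₗ[k] V b))
    (a v : Q) : ℕ :=
  pathLen φ (hQ.exists_admissible a v).choose

variable {H : Set Q} [Fintype H]

/-- The linear functional `q ↦ ∑ h, q h * max (v - h)`, the maximum being that of the coordinates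
of `v - h` in the coordinates of the vertices given by the base vertex `a`. -/
noncomputable def slope (hQ : IsZnQuiver ty) (H : Set Q) [Fintype H] (a v : Q) :
    (H → ℝ) →ₗ[ℝ] ℝ :=
  ∑ h : H, (maxDiff (hQ.admType a v) (hQ.admType a h) : ℝ) • LinearMap.proj h

/-- The function of the vertex `v`, affine in `q`, whose minima over `v` define the tiling. -/
noncomputable def height (hQ : IsZnQuiver ty) (φ : ∀ ⦃a b : Q⦄, (a ⟶ b) → (V a →ₗ[k] V b))
    (a : Q) (q : H → ℝ) (v : Q) : ℝ :=
  slope hQ H a v q - potential hQ φ a v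

theorem slope_apply (hQ : IsZnQuiver ty) (a v : Q) (q : H → ℝ) :
    slope hQ H a v q = ∑ h : H, q h * (maxDiff (hQ.admType a v) (hQ.admType a h) : ℝ) := by
  simp [slope, mul_comm]

variable (hV : IsLinkedNet ty φ) (hQ : IsZnQuiver ty) (hexact : IsExact ty φ)
  [∀ v, FiniteDimensional k (V v)] (hdim : ∀ v : Q, Module.finrank k (V v) = r + 1)
include hV hexact hdim

theorem height_sub_height (a : Q) {q : H → ℝ} (hq : ∑ h, q h = r + 1) {v u : Q} (γ : Path v u) :
    height hQ φ a q u - height hQ φ a q v =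
      ∑ h : H, q h * (maxDiff (typeCount ty γ) (hQ.admType v h) : ℝ) - pathLen φ γ := by
  obtain ⟨m, hm⟩ := hQ.exists_admType_add a γ
  have hpot : potential hQ φ a v + pathLen φ γ = potential hQ φ a u + m * (r + 1) := by
    rw [potential, ← pathLen_comp]
    refine hV.pathLen_eq_add_mul hQ hexact hdim _ _ m fun t => ?_
    rw [typeCount_comp]
    exact hm t
  have hmax : ∀ h : H, (maxDiff (hQ.admType a u) (hQ.admType a h) : ℝ) =
      maxDiff (hQ.admType a v) (hQ.admType a h) +
        maxDiff (typeCount ty γ) (hQ.admType v h) - m := fun h => by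
    obtain ⟨l, hl⟩ := hQ.exists_admType_add a (hQ.exists_admissible v (h : Q)).choose
    have hl' : ∀ t, hQ.admType a v t + hQ.admType v h t = hQ.admType a h t + l := hl
    have h₁ : maxDiff 0 (hQ.admType v h) + (l : ℤ) =
        maxDiff (hQ.admType a v) (hQ.admType a h) := maxDiff_add_eq fun i => by
      have := hl' i
      simp only [Pi.zero_apply]
      omega
    have h₂ : maxDiff (typeCount ty γ) (hQ.admType v h) + ((l : ℤ) - m) =
        maxDiff (hQ.admType a u) (hQ.admType a h) := maxDiff_add_eq fun i => by
      have := hl' i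
      have := hm i
      omega
    rw [maxDiff_zero (hQ.exists_admType_eq_zero v h)] at h₁
    rw [← h₁, ← h₂]
    push_cast
    ring
  have hpot' : (potential hQ φ a v : ℝ) + pathLen φ γ = potential hQ φ a u + m * (r + 1) := by
    exact_mod_cast hpot
  have hsum : ∑ h : H, q h * (maxDiff (hQ.admType a u) (hQ.admType a h) : ℝ) =
      ∑ h : H, q h * (maxDiff (hQ.admType a v) (hQ.admType a h) : ℝ) +
        ∑ h : H, q h * (maxDiff (typeCount ty γ) (hQ.admType v h) : ℝ) - (r + 1) * m := by
    rw [← hq, Finset.sum_mul, ← Finset.sum_add_distrib, ← Finset.sum_sub_distrib]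
    exact Finset.sum_congr rfl fun h _ => by rw [hmax]; ring
  rw [height, height, slope_apply, slope_apply, hsum]
  linarith

/-- Along a path of type `e_J` the height grows by the mass of `q` at the vertices `h` such that the
admissible paths from `v` to `h` avoid some type in `J`, minus the dimension of the kernel. -/
theorem height_sub_height_of_simple (a : Q) {q : H → ℝ} (hq : ∑ h, q h = r + 1) {v u : Q}
    {γ : Path v u} {J : Finset (Fin (n + 1))} (hγ : typeCount ty γ = ind J) :
    height hQ φ a q u - height hQ φ a q v =
      ∑ h ∈ Finset.univ.filter fun h : H => ∃ i ∈ J, hQ.admType v h i = 0, q h -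
        Module.finrank k (typeKer hQ φ v (ind J)) := by
  rw [height_sub_height hV hQ hexact hdim a hq γ, hexact.pathLen_eq_finrank hQ γ
    (fun t => by rw [hγ]; exact ind_le_one J t), hV.ker_eq_typeKer hQ, hγ, Finset.sum_filter]
  congr 1
  refine Finset.sum_congr rfl fun h _ => ?_
  rw [maxDiff_ind J (hQ.exists_admType_eq_zero v h)]
  split_ifs <;> simp

/-- A generating vertex is no higher than the vertices it generates, since the maps along a path
between them have zero kernels. -/
theorem height_le_of_generates (a : Q) {q : H → ℝ} (hq0 : ∀ h, 0 ≤ q h)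
    (hq : ∑ h, q h = r + 1) {v u : Q} (h : Generates φ v u) :
    height hQ φ a q v ≤ height hQ φ a q u := by
  obtain ⟨γ, hγ⟩ := h
  have hlen : pathLen φ γ = 0 := by
    clear hq
    induction γ with
    | nil => rfl
    | @cons b c p e ih =>
      have he : Function.Surjective (φ e) := Function.Surjective.of_comp hγ
      have he' : Function.Injective (φ e) :=
        (LinearMap.injective_iff_surjective_of_finrank_eq_finrank (by rw [hdim, hdim])).2 he
      have hp : Function.Surjective (pathMap φ p) := fun s => by
        obtain ⟨s', hs'⟩ := hγ (φ e s)
        exact ⟨s', he' hs'⟩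
      rw [pathLen, ih hp, LinearMap.ker_eq_bot.2 he', finrank_bot]
  have hdiff := height_sub_height hV hQ hexact hdim a hq γ
  have hnn : 0 ≤ ∑ h : H, q h * (maxDiff (typeCount ty γ) (hQ.admType v h) : ℝ) :=
    Finset.sum_nonneg fun h _ => mul_nonneg (hq0 h) (by
      obtain ⟨i, hi⟩ := hQ.exists_admType_eq_zero v h
      have := le_maxDiff (typeCount ty γ) (hQ.admType v h) i
      exact_mod_cast (by omega : (0 : ℤ) ≤ _))
  rw [hlen] at hdiff
  push_cast at hdiff
  linarith

/-- A local minimum of `height` is a global one. This is an instance of the convexity of `height` as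
a function of the vertex: the last layer of a path, made of the arrow types that occur most often in
it, increases `height` at least as much as the same arrows would at the beginning. -/
theorem height_le_of_forall_simple (a : Q) {q : H → ℝ} (hq0 : ∀ h, 0 ≤ q h)
    (hq : ∑ h, q h = r + 1) {v : Q}
    (hloc : ∀ u, ∀ γ : Path v u, IsSimple ty γ → IsAdmissible ty γ →
      height hQ φ a q v ≤ height hQ φ a q u) (u : Q) :
    height hQ φ a q v ≤ height hQ φ a q u := by
  obtain ⟨γ, hγ⟩ := hQ.exists_admissible v u
  induction hN : ∑ t, typeCount ty γ t using Nat.strong_induction_on generalizing u with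
  | _ N ih =>
    obtain ⟨i, -, hi⟩ := Finset.exists_max_image Finset.univ (typeCount ty γ) Finset.univ_nonempty
    by_cases hi0 : typeCount ty γ i = 0
    · obtain rfl : u = v := hQ.end_eq_of_typeCount_eq (γ := γ) (δ := Path.nil) (by
        ext t
        have := hi t (Finset.mem_univ t)
        simp only [typeCount]
        omega)
      exact le_rfl
    set J := Finset.univ.filter fun t => typeCount ty γ t = typeCount ty γ i with hJ
    have hJmem : ∀ t, t ∈ J ↔ typeCount ty γ t = typeCount ty γ i := fun t => by simp [hJ]
    have hJi : ∀ t, ind J t = if typeCount ty γ t = typeCount ty γ i then 1 else 0 := fun t => by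
      simp [ind, hJmem]
    have hsplit : ∀ t, typeCount ty γ t = (typeCount ty γ t - ind J t) + ind J t := fun t => by
      rw [hJi]
      split_ifs <;> omega
    obtain ⟨z, γ₁, γ₂, h₁, h₂⟩ := hQ.exists_factor γ _ _ hsplit
    have h₁' : ∀ t, typeCount ty γ₁ t + 1 ≤ typeCount ty γ i := fun t => by
      have := hi t (Finset.mem_univ t)
      rw [h₁]
      beta_reduce
      rw [hJi]
      split_ifs <;> omega
    have hsum : ∀ t, typeCount ty γ t = typeCount ty γ₁ t + ind J t := fun t => by
      rw [h₁]; exact hsplit t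
    obtain ⟨l, hl⟩ := hγ
    have hlJ : ind J l = 0 := by
      have := hsum l
      omega
    have hz := ih (∑ t, typeCount ty γ₁ t) (by
      rw [← hN]
      refine Finset.sum_lt_sum (fun t _ => by rw [hsum]; omega) ⟨i, Finset.mem_univ i, ?_⟩
      have := h₁' i
      omega) z γ₁ ⟨l, by have := hsum l; omega⟩ rfl
    obtain ⟨v', η, hη⟩ := hQ.exists_path_typeCount_eq v (ind J)
    have hv' := hloc v' η (fun t => by rw [hη]; exact ind_le_one J t) ⟨l, by rw [hη]; exact hlJ⟩
    -- The path back from `z` to `v` avoids the types in `J`.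
    obtain ⟨v'', ε, hε⟩ := hQ.exists_path_typeCount_eq z
      fun t => typeCount ty γ i - 1 - typeCount ty γ₁ t
    obtain rfl : v'' = v := hQ.end_eq_of_add (γ := γ₁.comp ε) (δ := Path.nil)
      (typeCount ty γ i - 1) fun t => by
        have := h₁' t
        rw [typeCount_comp, hε]
        simp only [typeCount]
        omega
    have hεJ : ∀ t, typeCount ty ε t = 0 ∨ ind J t = 0 := fun t => by
      have h := hsum t
      have h' := hJi t
      rw [hε]
      beta_reduce
      split_ifs at h' <;> omega
    have hker : Module.finrank k (typeKer hQ φ z (ind J)) ≤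
        Module.finrank k (typeKer hQ φ v'' (ind J)) :=
      hV.finrank_typeKer_le hQ ε ⟨i, (hεJ i).resolve_right (by simp [hJi])⟩ ⟨l, hlJ⟩ hεJ
    have hlen₂ : pathLen φ γ₂ = Module.finrank k (typeKer hQ φ z (ind J)) := by
      rw [hexact.pathLen_eq_finrank hQ γ₂ (fun t => by rw [h₂]; exact ind_le_one J t),
        hV.ker_eq_typeKer hQ, h₂]
    have hlenη : pathLen φ η = Module.finrank k (typeKer hQ φ v'' (ind J)) := by
      rw [hexact.pathLen_eq_finrank hQ η (fun t => by rw [hη]; exact ind_le_one J t),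
        hV.ker_eq_typeKer hQ, hη]
    have hlen : (pathLen φ γ : ℝ) ≤ pathLen φ γ₁ + pathLen φ η := by
      rw [hV.pathLen_eq_of_typeCount_eq hQ hexact γ (γ₁.comp γ₂)
        (by ext t; rw [typeCount_comp, h₂, hsum]), pathLen_comp, hlen₂, hlenη]
      exact_mod_cast Nat.add_le_add_left hker _
    have hmax : ∑ h : H, q h * (maxDiff (typeCount ty η) (hQ.admType v'' h) : ℝ) +
        ∑ h : H, q h * (maxDiff (typeCount ty γ₁) (hQ.admType v'' h) : ℝ) ≤
        ∑ h : H, q h * (maxDiff (typeCount ty γ) (hQ.admType v'' h) : ℝ) := by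
      rw [← Finset.sum_add_distrib]
      refine Finset.sum_le_sum fun h _ => ?_
      rw [← mul_add]
      refine mul_le_mul_of_nonneg_left ?_ (hq0 h)
      rw [hη]
      exact_mod_cast maxDiff_ind_add_le J (hQ.exists_admType_eq_zero v'' h) hsum
        (fun j hj t => by rw [(hJmem j).1 hj]; exact h₁' t)
    have e₁ := height_sub_height hV hQ hexact hdim a hq γ
    have e₂ := height_sub_height hV hQ hexact hdim a hq γ₁
    have e₃ := height_sub_height hV hQ hexact hdim a hq η
    linarith

end Height

/-! ### Base polytopes as minimum loci of the height -/

section BasePolytopes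

/-- The base polytope of a supermodular function is nonempty, by the greedy algorithm. -/
theorem exists_forall_le_sum_of_supermodular {ι : Type*} [DecidableEq ι] (f : Finset ι → ℝ)
    (h0 : f ∅ = 0) (hf : ∀ I J, f I + f J ≤ f (I ∪ J) + f (I ∩ J)) (A : Finset ι) :
    ∃ q : ι → ℝ, ∑ v ∈ A, q v = f A ∧ ∀ I ⊆ A, f I ≤ ∑ v ∈ I, q v := by
  induction A using Finset.induction_on with
  | empty => exact ⟨0, by simp [h0], fun I hI => by simp [Finset.subset_empty.1 hI, h0]⟩
  | insert a A ha ih =>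
    obtain ⟨q, hq, hle⟩ := ih
    have hsum : ∀ I ⊆ A, ∑ v ∈ I, Function.update q a (f (insert a A) - f A) v = ∑ v ∈ I, q v :=
      fun I hI => Finset.sum_congr rfl fun v hv =>
        Function.update_of_ne (fun h : v = a => ha (h ▸ hI hv)) _ _
    refine ⟨Function.update q a (f (insert a A) - f A), ?_, fun I hI => ?_⟩
    · rw [Finset.sum_insert ha, hsum A subset_rfl, hq, Function.update_self]
      ring
    · by_cases haI : a ∈ I
      · have hIA : I.erase a ⊆ A := fun v hv =>
          (Finset.mem_insert.1 (hI (Finset.mem_of_mem_erase hv))).resolve_left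
            (Finset.ne_of_mem_erase hv)
        have h₁ := hf I A
        have h₂ : I ∪ A = insert a A := by
          ext v
          have := @hI v
          simp only [Finset.mem_union, Finset.mem_insert] at this ⊢
          constructor
          · rintro (h | h)
            exacts [this h, Or.inr h]
          · rintro (rfl | h)
            exacts [Or.inl haI, Or.inr h]
        have h₃ : I ∩ A = I.erase a := by
          ext v
          simp only [Finset.mem_inter, Finset.mem_erase]
          exact ⟨fun h => ⟨fun hv => ha (hv ▸ h.2), h.1⟩,
            fun h => ⟨h.2, hIA (Finset.mem_erase.2 h)⟩⟩
        rw [h₂, h₃] at h₁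
        rw [← Finset.add_sum_erase I _ haI, hsum _ hIA, Function.update_self]
        have := hle _ hIA
        linarith
      · have hIA : I ⊆ A := fun v hv =>
          (Finset.mem_insert.1 (hI hv)).resolve_left fun h => haI (h ▸ hv)
        rw [hsum I hIA]
        exact hle I hIA

theorem mem_basePolytope_iff {H : Type*} [Fintype H] {μ : Finset H → ℝ} (h0 : 0 ≤ μ ∅)
    {q : H → ℝ} :
    q ∈ basePolytope μ ↔ ∑ v, q v = μ Finset.univ ∧ ∀ I, μ I ≤ ∑ v ∈ I, q v := by
  classical
  constructor
  · intro hq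
    refine ⟨le_antisymm ?_ (hq Finset.univ).1, fun I => (hq I).1⟩
    have := (hq Finset.univ).2
    simp only [adjoint, Finset.sdiff_self] at this
    linarith
  · rintro ⟨hq, hle⟩ I
    refine ⟨hle I, ?_⟩
    have h₁ := hle (Finset.univ \ I)
    have h₂ := Finset.sum_sdiff (f := q) (Finset.subset_univ I)
    have h₃ : adjoint μ I = μ Finset.univ - μ (Finset.univ \ I) := by
      unfold adjoint
      congr!
    rw [h₃]
    linarith

theorem isPolytope_basePolytope {H : Type*} [Fintype H] {μ : Finset H → ℝ} {d : ℝ}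
    (h : basePolytope μ ⊆ Omega H d) : IsPolytope (basePolytope μ) := by
  refine ⟨(Metric.isBounded_Icc (0 : H → ℝ) fun _ => d).subset fun q hq => ?_,
    Set.range (fun I : Finset H => (-∑ v ∈ I, LinearMap.proj v, -μ I)) ∪
      Set.range (fun I : Finset H => (∑ v ∈ I, LinearMap.proj v, adjoint μ I)),
    (Set.finite_range _).union (Set.finite_range _), ?_⟩
  · obtain ⟨h0, hd⟩ := h hq
    refine ⟨h0, fun v => ?_⟩
    rw [← hd]
    exact Finset.single_le_sum (fun v _ => h0 v) (Finset.mem_univ v)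
  · ext q
    simp only [basePolytope, Set.mem_ofPred_eq, Set.mem_union, or_imp, forall_and,
      Set.forall_mem_range, LinearMap.neg_apply, LinearMap.sum_apply, LinearMap.proj_apply,
      neg_le_neg_iff]

variable {k : Type x} [Field k] {Q : Type u} [Quiver.{w} Q] {n r : ℕ}
  {ty : ∀ ⦃a b : Q⦄, (a ⟶ b) → Fin (n + 1)}
  {V : Q → Type y} [∀ v, AddCommGroup (V v)] [∀ v, Module k (V v)]
  {φ : ∀ ⦃a b : Q⦄, (a ⟶ b) → (V a →ₗ[k] V b)}
  {H : Set Q} {γ : ∀ v u : H, Path (v : Q) (u : Q)}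

/-- The elements of `V_v` whose images at the vertices of `H` outside `I` vanish. -/
def vanishing (φ : ∀ ⦃a b : Q⦄, (a ⟶ b) → (V a →ₗ[k] V b))
    (γ : ∀ v u : H, Path (v : Q) (u : Q)) (v : H) (I : Finset H) : Submodule k (V v) :=
  ⨅ u ∉ I, LinearMap.ker (pathMap φ (γ v u))

theorem mem_vanishing {v : H} {I : Finset H} {s : V v} :
    s ∈ vanishing φ γ v I ↔ ∀ u ∉ I, pathMap φ (γ v u) s = 0 := by
  simp [vanishing, Submodule.mem_iInf]

variable (hQ : IsZnQuiver ty) (hγ : ∀ v u, IsAdmissible ty (γ v u))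
include hQ hγ

theorem mu_eq_finrank_vanishing (v : H) (I : Finset H) :
    mu (subspaceW φ γ v) I = Module.finrank k (vanishing φ γ v I) := by
  have hinj : Function.Injective (LinearMap.pi fun u : H => pathMap φ (γ v u)) := by
    intro s s' h
    have := congrFun h v
    simp only [LinearMap.pi_apply] at this
    rwa [hQ.eq_nil_of_isAdmissible (γ v v) (hγ v v)] at this
  have hmap : subspaceW φ γ v ⊓ Submodule.pi {v | v ∉ I} (fun _ => (⊥ : Submodule k (V _))) =
      (vanishing φ γ v I).map (LinearMap.pi fun u : H => pathMap φ (γ v u)) := by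
    rw [subspaceW, ← Submodule.map_comap_eq]
    congr 1
    ext s
    simp [mem_vanishing, Submodule.mem_pi]
  rw [mu, hmap, (Submodule.equivMapOfInjective _ hinj _).finrank_eq]

variable [Fintype H] (hdim : ∀ v : Q, Module.finrank k (V v) = r + 1)

include hdim in
theorem mem_basePolytope_mu_iff (v : H) {q : H → ℝ} :
    q ∈ basePolytope (mu (subspaceW φ γ v)) ↔ ∑ h, q h = r + 1 ∧
      ∀ I : Finset H, (Module.finrank k (vanishing φ γ v I) : ℝ) ≤ ∑ h ∈ I, q h := by
  have htop : vanishing φ γ v Finset.univ = ⊤ := by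
    ext s; simp [mem_vanishing]
  rw [mem_basePolytope_iff (by unfold mu; positivity)]
  simp only [mu_eq_finrank_vanishing hQ hγ]
  rw [htop, finrank_top, hdim]
  push_cast
  rfl

include hdim in
theorem basePolytope_mu_subset_Omega (v : H) :
    basePolytope (mu (subspaceW φ γ v)) ⊆ Omega H (r + 1) := fun q hq => by
  obtain ⟨h₁, h₂⟩ := (mem_basePolytope_mu_iff hQ hγ hdim v).1 hq
  refine ⟨fun h => ?_, h₁⟩
  have := h₂ {h}
  rw [Finset.sum_singleton] at this
  exact le_trans (Nat.cast_nonneg _) this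

variable [∀ v, FiniteDimensional k (V v)]

include hdim in
theorem nonempty_basePolytope_mu (v : H) : (basePolytope (mu (subspaceW φ γ v))).Nonempty := by
  classical
  have htop : vanishing φ γ v Finset.univ = ⊤ := by
    ext s; simp [mem_vanishing]
  have hbot : vanishing φ γ v ∅ = ⊥ := by
    rw [eq_bot_iff]
    intro s hs
    have := mem_vanishing.1 hs v (Finset.notMem_empty v)
    rwa [hQ.eq_nil_of_isAdmissible (γ v v) (hγ v v)] at this
  have hsuper : ∀ I J,
      (Module.finrank k (vanishing φ γ v I) : ℝ) + Module.finrank k (vanishing φ γ v J) ≤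
        Module.finrank k (vanishing φ γ v (I ∪ J)) +
          Module.finrank k (vanishing φ γ v (I ∩ J)) := by
    intro I J
    have h₁ : vanishing φ γ v I ⊔ vanishing φ γ v J ≤ vanishing φ γ v (I ∪ J) :=
      sup_le (fun s hs => mem_vanishing.2 fun u hu => mem_vanishing.1 hs u
          fun h => hu (Finset.mem_union_left _ h))
        (fun s hs => mem_vanishing.2 fun u hu => mem_vanishing.1 hs u
          fun h => hu (Finset.mem_union_right _ h))
    have h₂ : vanishing φ γ v I ⊓ vanishing φ γ v J = vanishing φ γ v (I ∩ J) := by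
      ext s
      simp only [Submodule.mem_inf, mem_vanishing, Finset.mem_inter, not_and_or]
      exact ⟨fun h u hu => hu.elim (h.1 u) (h.2 u),
        fun h => ⟨fun u hu => h u (Or.inl hu), fun u hu => h u (Or.inr hu)⟩⟩
    have h₃ := Submodule.finrank_sup_add_finrank_inf_eq (vanishing φ γ v I) (vanishing φ γ v J)
    have h₄ := Submodule.finrank_mono h₁
    rw [h₂] at h₃
    have : Module.finrank k (vanishing φ γ v I) + Module.finrank k (vanishing φ γ v J) ≤
        Module.finrank k (vanishing φ γ v (I ∪ J)) +
          Module.finrank k (vanishing φ γ v (I ∩ J)) := by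
      omega
    exact_mod_cast this
  obtain ⟨q, hq, hle⟩ := exists_forall_le_sum_of_supermodular
    (fun I => (Module.finrank k (vanishing φ γ v I) : ℝ))
    (by rw [hbot, finrank_bot, Nat.cast_zero]) hsuper Finset.univ
  refine ⟨q, (mem_basePolytope_mu_iff hQ hγ hdim v).2
    ⟨hq.trans ?_, fun I => hle I (Finset.subset_univ I)⟩⟩
  rw [htop, finrank_top, hdim]
  push_cast
  rfl

variable (hV : IsLinkedNet ty φ) (hexact : IsExact ty φ)

omit hγ [Fintype H] [∀ v, FiniteDimensional k (V v)] in
include hV in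
theorem mem_typeKer_of_forall_mem {ι : Type*} {U : Finset ι} (hU : U.Nonempty)
    {A : ι → Fin (n + 1) → ℕ} (hA : ∀ j ∈ U, ∃ i, A j i = 0) {v : Q} {s : V v}
    (hs : ∀ j ∈ U, s ∈ typeKer hQ φ v (A j)) :
    s ∈ typeKer hQ φ v (ind (Finset.univ.filter fun i => ∀ j ∈ U, A j i ≠ 0)) := by
  induction hU using Finset.Nonempty.cons_induction with
  | singleton j =>
    simpa using hV.typeKer_le_support hQ v (hA j (Finset.mem_singleton_self j))
      (hs j (Finset.mem_singleton_self j))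
  | cons j U hj hU ih =>
    have h₁ := hV.typeKer_le_support hQ v (hA j (Finset.mem_cons_self j U))
      (hs j (Finset.mem_cons_self j U))
    have h₂ := ih (fun l hl => hA l (Finset.mem_cons_of_mem hl))
      (fun l hl => hs l (Finset.mem_cons_of_mem hl))
    have h₃ := hV.mem_typeKer_inf hQ ?_ ?_ h₁ h₂
    · refine hV.typeKer_mono hQ v (fun i => ?_) h₃
      simp only [ind, Pi.inf_apply, Finset.mem_filter, Finset.mem_univ, true_and,
        Finset.mem_cons, forall_eq_or_imp]
      split_ifs <;> first | decide | tauto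
    · obtain ⟨i, hi⟩ := hA j (Finset.mem_cons_self j U)
      exact ⟨i, by simp [ind, hi]⟩
    · obtain ⟨l, hl⟩ := hU
      obtain ⟨i, hi⟩ := hA l (Finset.mem_cons_of_mem hl)
      refine ⟨i, ?_⟩
      rw [ind, if_neg]
      simp only [Finset.mem_filter, Finset.mem_univ, true_and, not_forall]
      exact ⟨l, hl, fun h => h hi⟩

include hV hexact hdim

/-- The points of the base polytope at `v` are those for which `v` minimizes `height`: the
inequalities of the base polytope say that `v` is a local minimum. -/
theorem mem_basePolytope_mu_iff_height (a : Q) (v : H) {q : H → ℝ} :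
    q ∈ basePolytope (mu (subspaceW φ γ v)) ↔
      q ∈ Omega H (r + 1) ∧ ∀ u : Q, height hQ φ a q v ≤ height hQ φ a q u := by
  classical
  have hker : ∀ u : H, LinearMap.ker (pathMap φ (γ v u)) = typeKer hQ φ v (hQ.admType v u) :=
    fun u => by rw [hV.ker_eq_typeKer hQ, hQ.typeCount_eq_admType (hγ v u)]
  constructor
  · intro h
    have hΩ := basePolytope_mu_subset_Omega hQ hγ hdim v h
    obtain ⟨hq, hle⟩ := (mem_basePolytope_mu_iff hQ hγ hdim v).1 h
    refine ⟨hΩ, height_le_of_forall_simple hV hQ hexact hdim a hΩ.1 hq fun u δ hδ _ => ?_⟩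
    set J := Finset.univ.filter fun t => typeCount ty δ t ≠ 0 with hJ
    have hδJ : typeCount ty δ = ind J := by
      ext t
      have := hδ t
      simp only [ind, hJ, Finset.mem_filter, Finset.mem_univ, true_and]
      split_ifs <;> omega
    have hdiff := height_sub_height_of_simple hV hQ hexact hdim a hq hδJ
    have hle' := hle (Finset.univ.filter fun h : H => ∃ i ∈ J, hQ.admType v h i = 0)
    have hsub : typeKer hQ φ v (ind J) ≤ vanishing φ γ v
        (Finset.univ.filter fun h : H => ∃ i ∈ J, hQ.admType v h i = 0) := by
      intro s hs
      rw [mem_vanishing]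
      intro h hh
      rw [← LinearMap.mem_ker, hker]
      refine hV.typeKer_mono hQ v (fun i => ?_) hs
      unfold ind
      split_ifs with hi
      · rw [Nat.one_le_iff_ne_zero]
        exact fun h0 => hh (by simpa using ⟨i, hi, h0⟩)
      · exact Nat.zero_le _
    have hfin : (Module.finrank k (typeKer hQ φ v (ind J)) : ℝ) ≤ Module.finrank k (vanishing φ γ v
        (Finset.univ.filter fun h : H => ∃ i ∈ J, hQ.admType v h i = 0)) := by
      exact_mod_cast Submodule.finrank_mono hsub
    linarith
  · rintro ⟨⟨hq0, hq⟩, hmin⟩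
    refine (mem_basePolytope_mu_iff hQ hγ hdim v).2 ⟨hq, fun I => ?_⟩
    rcases (Finset.univ \ I).eq_empty_or_nonempty with hI | hI
    · have hI' : I = Finset.univ := by
        rw [Finset.sdiff_eq_empty_iff_subset] at hI
        exact Finset.univ_subset_iff.1 hI
      rw [hI', hq]
      have := (Submodule.finrank_le (vanishing φ γ v Finset.univ)).trans_eq (hdim v)
      exact_mod_cast this
    set J := Finset.univ.filter fun i => ∀ u ∈ Finset.univ \ I, hQ.admType v u i ≠ 0 with hJ
    have hsub : vanishing φ γ v I ≤ typeKer hQ φ v (ind J) := by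
      intro s hs
      have hs' : ∀ u ∈ Finset.univ \ I, s ∈ typeKer hQ φ v (hQ.admType v u) := fun u hu => by
        rw [← hker, LinearMap.mem_ker]
        exact mem_vanishing.1 hs u (Finset.mem_sdiff.1 hu).2
      convert mem_typeKer_of_forall_mem hQ hV hI (A := fun u : H => hQ.admType v u)
        (fun u _ => hQ.exists_admType_eq_zero v u) hs'
    obtain ⟨u, δ, hδ⟩ := hQ.exists_path_typeCount_eq v (ind J)
    have hdiff := height_sub_height_of_simple hV hQ hexact hdim a hq hδ
    have hu := hmin u
    have hfin : (Module.finrank k (vanishing φ γ v I) : ℝ) ≤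
        Module.finrank k (typeKer hQ φ v (ind J)) := by
      exact_mod_cast Submodule.finrank_mono hsub
    have hsum : ∑ h ∈ Finset.univ.filter fun h : H => ∃ i ∈ J, hQ.admType v h i = 0, q h ≤
        ∑ h ∈ I, q h := by
      refine Finset.sum_le_sum_of_subset_of_nonneg (fun h hh => ?_) fun h _ _ => hq0 h
      obtain ⟨i, hi, hi0⟩ := (Finset.mem_filter.1 hh).2
      by_contra hhI
      exact (Finset.mem_filter.1 hi).2 h
        (Finset.mem_sdiff.2 ⟨Finset.mem_univ h, hhI⟩) hi0
    linarith

theorem iUnion_basePolytope_mu (hgen : ∀ v, ∃ z ∈ H, Generates φ z v) :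
    ⋃ v : H, basePolytope (mu (subspaceW φ γ v)) = Omega H (r + 1) := by
  refine Set.Subset.antisymm
    (Set.iUnion_subset fun v => basePolytope_mu_subset_Omega hQ hγ hdim v) fun q hq => ?_
  obtain ⟨a, -⟩ : ∃ a ∈ (Finset.univ : Finset H), q a ≠ 0 :=
    Finset.exists_ne_zero_of_sum_ne_zero (by rw [hq.2]; positivity)
  obtain ⟨v, -, hv⟩ := Finset.exists_min_image Finset.univ
    (fun v : H => height hQ φ (a : Q) q v) ⟨a, Finset.mem_univ a⟩
  refine Set.mem_iUnion.2 ⟨v, (mem_basePolytope_mu_iff_height hQ hγ hdim hV hexact a v).2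
    ⟨hq, fun u => ?_⟩⟩
  obtain ⟨z, hz, hzu⟩ := hgen u
  exact (hv ⟨z, hz⟩ (Finset.mem_univ _)).trans
    (height_le_of_generates hV hQ hexact hdim a hq.1 hq.2 hzu)

theorem isFace_inter_basePolytope_mu (v u : H)
    (hne : (basePolytope (mu (subspaceW φ γ v)) ∩
      basePolytope (mu (subspaceW φ γ u))).Nonempty) :
    IsFace (basePolytope (mu (subspaceW φ γ v)))
      (basePolytope (mu (subspaceW φ γ v)) ∩ basePolytope (mu (subspaceW φ γ u))) := by
  have hmem : ∀ (z : H) {q : H → ℝ}, q ∈ basePolytope (mu (subspaceW φ γ z)) ↔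
      q ∈ Omega H (r + 1) ∧ ∀ u : Q, height hQ φ (v : Q) q z ≤ height hQ φ (v : Q) q u :=
    fun z => mem_basePolytope_mu_iff_height hQ hγ hdim hV hexact v z
  refine isFace_of_forall_le (l := slope hQ H v v - slope hQ H v u)
    (c := potential hQ φ (v : Q) v - potential hQ φ (v : Q) u) (fun q hq => ?_) ?_ hne
  · have := ((hmem v).1 hq).2 u
    simp only [height, LinearMap.sub_apply] at this ⊢
    linarith
  · ext q
    simp only [Set.mem_inter_iff, Set.mem_ofPred_eq]
    refine and_congr_right fun hq => ?_
    have hqv := (hmem v).1 hq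
    have hvu := hqv.2 u
    rw [hmem u]
    simp only [height, LinearMap.sub_apply] at hqv hvu ⊢
    constructor
    · intro h
      have := h.2 v
      linarith
    · intro h
      refine ⟨hqv.1, fun z => ?_⟩
      have := hqv.2 z
      linarith

end BasePolytopes

end LinkedNet

theorem theorem4p2 {k : Type x} [Field k] {Q : Type u} [Quiver.{w} Q] {n r : ℕ}
    (ty : ∀ ⦃a b : Q⦄, (a ⟶ b) → Fin (n + 1)) (hQ : LinkedNet.IsZnQuiver ty)
    {V : Q → Type y} [∀ v, AddCommGroup (V v)] [∀ v, Module k (V v)]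
    (φ : ∀ ⦃a b : Q⦄, (a ⟶ b) → (V a →ₗ[k] V b))
    (hV : LinkedNet.IsLinkedNet ty φ) (hexact : LinkedNet.IsExact ty φ)
    (hfg : LinkedNet.IsFinitelyGenerated φ)
    (hdim : ∀ v : Q, Module.finrank k (V v) = r + 1) :
    ∃ _ : Fintype (LinkedNet.minimumGenerators φ),
      ∀ γ : ∀ v u : LinkedNet.minimumGenerators φ, Quiver.Path (v : Q) (u : Q),
        (∀ v u, LinkedNet.IsAdmissible ty (γ v u)) →
        LinkedNet.IsPolyhedralTiling
          {F | ∃ v : LinkedNet.minimumGenerators φ,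
            F = LinkedNet.basePolytope (LinkedNet.mu (LinkedNet.subspaceW φ γ v)) ∨
            LinkedNet.IsFace
              (LinkedNet.basePolytope (LinkedNet.mu (LinkedNet.subspaceW φ γ v))) F}
          (LinkedNet.Omega (LinkedNet.minimumGenerators φ) (r + 1)) ∧
        ⋃ v : LinkedNet.minimumGenerators φ,
            LinkedNet.basePolytope (LinkedNet.mu (LinkedNet.subspaceW φ γ v)) =
          LinkedNet.Omega (LinkedNet.minimumGenerators φ) (r + 1) := by
  obtain ⟨hfin, hgen⟩ := LinkedNet.minimumGenerators_finite_and_generates hV hQ hdim hfg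
  have : ∀ v, FiniteDimensional k (V v) := fun v =>
    Module.finite_of_finrank_pos (by rw [hdim]; omega)
  refine ⟨hfin.fintype, fun γ hγ => ?_⟩
  let _ := hfin.fintype
  have hunion := LinkedNet.iUnion_basePolytope_mu hQ hγ hdim hV hexact hgen
  refine ⟨?_, hunion⟩
  rw [← hunion]
  exact LinkedNet.isPolyhedralTiling_faces
    (fun v => LinkedNet.isPolytope_basePolytope
      (LinkedNet.basePolytope_mu_subset_Omega hQ hγ hdim v))
    (LinkedNet.nonempty_basePolytope_mu hQ hγ hdim)
    (LinkedNet.isFace_inter_basePolytope_mu hQ hγ hdim hV hexact)
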